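/- Let $X$ be an abstract simplicial complex (possibly empty), whose simplices are nonempty finite sets of vertices, let $s\le t$ mean that $s$ is a face of $t$, and give the set of simplices of $X$ the Alexandrov topology of this partial order, whose open sets are the sets closed under passing to cofaces. For a simplex $s$ let $U_s=\{t\in X\mid s\le t\}$ be its smallest open neighbourhood. Let $\mathbf{M}$ be a Grothendieck abelian category in which products are exact, for example the category of modules, or of $\mathbb{N}_0$-graded modules, over a commutative ring. For a sheaf $\mathcal{F}$ on $X$ with values in $\mathbf{M}$ let $H^k(X,\mathcal{F})=R^k\Gamma(X,-)(\mathcal{F})$ be its sheaf cohomology, and let $\check H^k(X,\mathcal{F})=\operatorname{colim}_{\mathcal{U}}\check H^k(\mathcal{U},\mathcal{F})$, the colimit over all open covers of $X$ and their refinements, be its Čech cohomology. 1. For every $k\ge 0$ this colimit exists and is naturally isomorphic to sheaf cohomology: $\check H^k(X,-)\cong H^k(X,-)$. 2. The functor that sends a sheaf $\mathcal{F}$ to the functor $F$ on the face poset of $X$ with $F(s)=\mathcal{F}(U_s)$ is an equivalence between sheaves on $X$ and cellular sheaves on $X$ (functors from the face poset to $\mathbf{M}$). 3. The open cover $\mathcal{U}_0=(U_{\{x\}})_x$,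 with $x$ running over the vertices of $X$, refines every open cover of $X$, and its nerve is $X$. 4. Suppose that $X$ is finite, and fix any linear order on the vertices. For a cellular sheaf $F$ let $C^\bullet(X,F)$ be the cochain complex with $$C^k(X,F)=\bigoplus_{s\in X^k}F(s),\qquad \delta^k=\bigoplus_{t\in X^{k+1}}\Big(\sum_{t\ge s\in X^k}[s:t]\,F(s\to t)\circ p_s\Big),$$ where $X^k$ is the set of $k$-simplices, $p_s$ is the projection to $F(s)$, and $[s:t]=(-1)^j$ if $s$ arises from $t=\{x_0<\dots<x_{k+1}\}$ by removing $x_j$. Then for every $k\ge 0$ and every sheaf $\mathcal{F}$ with corresponding cellular sheaf $F$ there are isomorphisms, natural in $\mathcal{F}$, $$H^k(X,\mathcal{F})\;\cong\; H^k\big(C^\bullet(X,F)\big)\;\cong\;\check H^k(\mathcal{U}_0,\mathcal{F}).$$ -/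

import Mathlib

open CategoryTheory Limits TopologicalSpace Opposite

universe u v

namespace SimplicialSheaf

noncomputable section

/-! ### Simplicial complexes as Alexandrov spaces -/

section Space

variable {V : Type u} (X : PreAbstractSimplicialComplex V)

/-- The set of simplices of an abstract simplicial complex (a downward closed family of nonempty
finite sets of vertices). -/
structure Simplex : Type u where
  /-- the set of vertices of the simplex -/
  verts : Finset V
  verts_mem : verts ∈ X

variable {X}

lemma Simplex.verts_injective : Function.Injective (Simplex.verts (X := X)) := by
  rintro ⟨s, _⟩ ⟨t, _⟩ rfl
  rfl

lemma Simplex.verts_nonempty (s : Simplex X) : s.verts.Nonempty :=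
  (X.isRelLowerSet_faces s.verts_mem).1

/-- The face relation: `s ≤ t` iff `s` is a face of `t`. -/
instance : PartialOrder (Simplex X) := PartialOrder.lift Simplex.verts Simplex.verts_injective

lemma Simplex.le_iff {s t : Simplex X} : s ≤ t ↔ s.verts ⊆ t.verts := Iff.rfl

/-- The Alexandrov topology of the face relation poset: the open sets are the upper sets. -/
instance : TopologicalSpace (Simplex X) := Topology.upperSet (Simplex X)

instance : Topology.IsUpperSet (Simplex X) := ⟨rfl⟩

variable (X)

/-- The simplicial complex `X` viewed as a topological space with the Alexandrov topology. -/
abbrev space : TopCat.{u} := TopCat.of (Simplex X)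

/-- The set of `k`-simplices of `X`. -/
abbrev SimplexOfDim (k : ℕ) : Type u := {s : Simplex X // s.verts.card = k + 1}

/-- The vertices of `X`. -/
abbrev Vertex : Type u := {x : V // {x} ∈ X}

variable {X}

/-- A vertex, viewed as a `0`-simplex. -/
def Vertex.simplex (x : Vertex X) : Simplex X := ⟨{x.1}, x.2⟩

end Space

/-! ### The category of sheaves -/

section Sheafify

variable (P : Type u) [TopologicalSpace P] [Preorder P] [Topology.IsUpperSet P]

/-- The functor sending a point of an Alexandrov space to its smallest open neighbourhood. -/
def minNhds : Pᵒᵖ ⥤ Opens (TopCat.of P) := (Alexandrov.principals P).leftOp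

instance : (minNhds P).Full where
  map_surjective {a b} f := ⟨(homOfLE (show b.unop ≤ a.unop from
    (Alexandrov.principalOpen_le_iff _).1 f.le)).op, Subsingleton.elim _ _⟩

instance : (minNhds P).Faithful where
  map_injective _ := Subsingleton.elim (α := _ ⟶ _) _ _

instance : (minNhds P).IsCoverDense (Opens.grothendieckTopology (TopCat.of P)) where
  is_cover _ x hx :=
    ⟨Alexandrov.principalOpen (X := P) x, homOfLE ((Alexandrov.principalOpen_le_iff _).2 hx),
      ⟨⟨op x, 𝟙 _, homOfLE ((Alexandrov.principalOpen_le_iff _).2 hx), rfl⟩⟩,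
      Alexandrov.self_mem_principalOpen (X := P) x⟩

instance : (minNhds P).IsDenseSubsite ⊥ (Opens.grothendieckTopology (TopCat.of P)) where
  functorPushforward_mem_iff {a S} := by
    rw [GrothendieckTopology.bot_covering]
    constructor
    · intro h
      obtain ⟨W, f, ⟨b, g, k, hg, _⟩, hW⟩ :=
        h a.unop (Alexandrov.self_mem_principalOpen (X := P) a.unop)
      have hb : b.unop ≤ a.unop := k.le hW
      have h1 := S.downward_closed hg (homOfLE hb).op
      rwa [Subsingleton.elim ((homOfLE hb).op ≫ g) (𝟙 a), Sieve.id_mem_iff_eq_top] at h1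
    · rintro rfl
      rw [Sieve.functorPushforward_top]
      exact GrothendieckTopology.top_mem _ _

/-- Presheaves on an Alexandrov space with values in a complete category have sheafifications. -/
instance (M : Type v) [Category.{u} M] [HasLimits M] :
    HasSheafify (Opens.grothendieckTopology (TopCat.of P)) M :=
  Functor.IsDenseSubsite.hasSheafify_of_isEquivalence
    (⊥ : GrothendieckTopology Pᵒᵖ) _ (minNhds P)

end Sheafify

/-! ### Sheaf cohomology, cellular cohomology and Čech cohomology -/

section Cohomology

variable {V : Type u} (X : PreAbstractSimplicialComplex V)
variable (M : Type v) [Category.{u} M] [Abelian M] [IsGrothendieckAbelian.{u} M]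

/-- The global section functor `Γ(X, -)`. -/
def globalSections : TopCat.Sheaf M (space X) ⥤ M :=
  TopCat.Sheaf.forget M (space X) ⋙ (evaluation (Opens (space X))ᵒᵖ M).obj (op ⊤)

instance : (globalSections X M).Additive where

/-- The `k`-th sheaf cohomology functor: the `k`-th right derived functor of `Γ(X, -)`. -/
def sheafCohomology (k : ℕ) : TopCat.Sheaf M (space X) ⥤ M :=
  (globalSections X M).rightDerived k

/-- The functor `F` on the face relation poset corresponding to a sheaf `ℱ` on `X`: its value at
a simplex `s` is `ℱ(U_s)`, where `U_s` is the set of all simplices containing `s`. -/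
def toCellular : TopCat.Sheaf M (space X) ⥤ (Simplex X ⥤ M) :=
  TopCat.Sheaf.forget M (space X) ⋙
    (Functor.whiskeringLeft (Simplex X) (Opens (space X))ᵒᵖ M).obj
      (Alexandrov.principals (Simplex X))

end Cohomology

section Cellular

variable {V : Type u} [LinearOrder V] {X : PreAbstractSimplicialComplex V}
variable {M : Type v} [Category.{u} M] [Abelian M]

/-- The orientation coefficient `[s : t]`: it is `(-1) ^ j` if `s` arises from
`t = {x₀ < ⋯ < x_{k+1}}` by removing `x_j`, and zero if `s` arises from `t` in no such way. -/
def incidence (s t : Finset V) : ℤ :=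
  ∑ x ∈ t, if t.erase x = s then (-1) ^ (t.filter (· < x)).card else 0

/-- The component `[s : t] F(s → t)` of the cellular coboundary, zero unless `s ≤ t`. -/
def coboundaryEntry (F : Simplex X ⥤ M) (s t : Simplex X) : F.obj s ⟶ F.obj t :=
  open Classical in
  if h : s ≤ t then incidence s.verts t.verts • F.map (homOfLE h) else 0

lemma sum_incidence (s t : Finset V) : ∑ x ∈ t, (-1) ^ (t.filter (· < x)).card *
    incidence s (t.erase x) = 0 := by
  unfold incidence
  simp only [Finset.mul_sum]
  rw [Finset.sum_sigma']
  refine Finset.sum_involution (fun p _ => ⟨p.2, p.1⟩) ?_ ?_ ?_ ?_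
  · rintro ⟨x, y⟩ h
    simp only [Finset.mem_sigma, Finset.mem_erase] at h
    obtain ⟨hx, hyx, hy⟩ := h
    dsimp only
    rw [Finset.erase_right_comm (a := y)]
    split_ifs
    · have key : ∀ a b : V, a ∈ t → b ∈ t → a < b →
          (t.filter (· < b)).card = ((t.erase a).filter (· < b)).card + 1 ∧
          (t.filter (· < a)).card = ((t.erase b).filter (· < a)).card := by
        intro a b ha hb hab
        rw [Finset.filter_erase, Finset.filter_erase,
          Finset.card_erase_add_one (by simp [ha, hab]),
          Finset.erase_eq_of_notMem (by simp [hab.le])]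
        exact ⟨rfl, rfl⟩
      rcases lt_or_gt_of_ne hyx with h | h
      · rw [(key y x hy hx h).1, (key y x hy hx h).2]
        ring
      · rw [(key x y hx hy h).1, (key x y hx hy h).2]
        ring
    · simp
  · rintro ⟨x, y⟩ h _ h'
    simp only [Finset.mem_sigma, Finset.mem_erase] at h
    simp only [Sigma.mk.injEq] at h'
    exact h.2.1 h'.1
  · rintro ⟨x, y⟩ h
    simp only [Finset.mem_sigma, Finset.mem_erase] at h ⊢
    exact ⟨h.2.2, h.2.1.symm, h.1⟩
  · rintro ⟨x, y⟩ _
    rfl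

lemma incidence_eq_zero {s t : Finset V} (h : ¬ s ⊆ t) : incidence s t = 0 :=
  Finset.sum_eq_zero fun x _ => if_neg fun hx =>
    h (hx.symm.subset.trans (Finset.erase_subset x t))

lemma coboundaryEntry_comp (F : Simplex X ⥤ M) {s t : Simplex X} (h : s ≤ t) (r : Simplex X) :
    coboundaryEntry F s r ≫ coboundaryEntry F r t =
      (incidence s.verts r.verts * incidence r.verts t.verts) • F.map (homOfLE h) := by
  unfold coboundaryEntry
  by_cases h1 : s ≤ r
  · by_cases h2 : r ≤ t
    · rw [dif_pos h1, dif_pos h2, Preadditive.zsmul_comp, Preadditive.comp_zsmul, ← F.map_comp,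
        smul_smul]
      rfl
    · rw [dif_neg h2, incidence_eq_zero h2, mul_zero, zero_smul, comp_zero]
  · rw [dif_neg h1, incidence_eq_zero h1, zero_mul, zero_smul, zero_comp]

lemma sum_incidence_simplex {k : ℕ} [Fintype (SimplexOfDim X (k + 1))]
    (s : SimplexOfDim X k) (t : SimplexOfDim X (k + 2)) :
    ∑ r : SimplexOfDim X (k + 1),
      incidence s.1.verts r.1.verts * incidence r.1.verts t.1.verts = 0 := by
  rw [← sum_incidence s.1.verts t.1.verts]
  conv_lhs =>
    enter [2, r, 2]
    unfold incidence
  simp only [Finset.mul_sum]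
  rw [Finset.sum_comm]
  refine Finset.sum_congr rfl fun x hx => ?_
  have hc : (t.1.verts.erase x).card = k + 1 + 1 := by
    rw [Finset.card_erase_of_mem hx, t.2]
    rfl
  have hm : t.1.verts.erase x ∈ X := (X.isRelLowerSet_faces t.1.verts_mem).2
    (Finset.erase_subset _ _) (Finset.card_pos.1 (by omega))
  rw [Finset.sum_eq_single (⟨⟨t.1.verts.erase x, hm⟩, hc⟩ : SimplexOfDim X (k + 1))]
  · rw [if_pos (by rfl), mul_comm]
  · intro r _ hr
    rw [if_neg, mul_zero]
    intro h
    exact hr (Subtype.ext (Simplex.verts_injective h.symm))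
  · intro h
    exact absurd (Finset.mem_univ _) h

lemma coboundaryEntry_naturality {F G : Simplex X ⥤ M} (φ : F ⟶ G) (s t : Simplex X) :
    φ.app s ≫ coboundaryEntry G s t = coboundaryEntry F s t ≫ φ.app t := by
  unfold coboundaryEntry
  split_ifs <;> simp

variable [Finite (Simplex X)]

attribute [local instance] Abelian.hasFiniteBiproducts

lemma lift_comp_desc {J : Type u} [Fintype J] {f : J → M} [HasBiproduct f] {A B : M}
    (g : ∀ j, A ⟶ f j) (h : ∀ j, f j ⟶ B) :
    biproduct.lift g ≫ biproduct.desc h = ∑ j, g j ≫ h j := by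
  classical
  have : biproduct.lift g = ∑ j, g j ≫ biproduct.ι f j :=
    biproduct.hom_ext _ _ fun j => by
      simp [Preadditive.sum_comp, biproduct.ι_π, comp_dite]
  simp [this, Preadditive.sum_comp]

/-- The cellular cochains `⨁ F(s)`, the sum being over all `k`-simplices `s`. -/
abbrev cochains (F : Simplex X ⥤ M) (k : ℕ) : M :=
  ⨁ fun s : SimplexOfDim X k => F.obj s.1

/-- The cellular coboundary. -/
def coboundary (F : Simplex X ⥤ M) (k : ℕ) : cochains F k ⟶ cochains F (k + 1) :=
  biproduct.lift fun t : SimplexOfDim X (k + 1) =>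
    biproduct.desc fun s : SimplexOfDim X k => coboundaryEntry F s.1 t.1

lemma coboundary_comp (F : Simplex X ⥤ M) (k : ℕ) :
    coboundary F k ≫ coboundary F (k + 1) = 0 := by
  classical
  have := Fintype.ofFinite (SimplexOfDim X (k + 1))
  refine biproduct.hom_ext' _ _ fun s => biproduct.hom_ext _ _ fun t => ?_
  have h1 : biproduct.ι (fun s : SimplexOfDim X k => F.obj s.1) s ≫ coboundary F k =
      biproduct.lift fun r : SimplexOfDim X (k + 1) => coboundaryEntry F s.1 r.1 :=
    biproduct.hom_ext _ _ fun r => by simp [coboundary]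
  have h2 : coboundary F (k + 1) ≫ biproduct.π (fun t : SimplexOfDim X (k + 2) => F.obj t.1) t =
      biproduct.desc fun r : SimplexOfDim X (k + 1) => coboundaryEntry F r.1 t.1 := by
    simp [coboundary]
  rw [← Category.assoc, h1, Category.assoc, h2, comp_zero, zero_comp]
  rw [lift_comp_desc]
  by_cases hst : s.1 ≤ t.1
  · rw [Finset.sum_congr rfl fun r _ => coboundaryEntry_comp F hst r.1, ← Finset.sum_smul,
      sum_incidence_simplex s t, zero_smul]
  · refine Finset.sum_eq_zero fun r _ => ?_
    unfold coboundaryEntry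
    by_cases h : s.1 ≤ r.1
    · rw [dif_neg (fun h' : r.1 ≤ t.1 => hst (h.trans h')), comp_zero]
    · rw [dif_neg h, zero_comp]

/-- The cellular cochain complex of a functor on the face relation poset. -/
def cellularComplex (F : Simplex X ⥤ M) : CochainComplex M ℕ :=
  CochainComplex.of (cochains F) (coboundary F) (coboundary_comp F)

/-- The morphism of cellular cochains induced by a natural transformation. -/
def cochainsMap {F G : Simplex X ⥤ M} (φ : F ⟶ G) (k : ℕ) : cochains F k ⟶ cochains G k :=
  biproduct.map fun s : SimplexOfDim X k => φ.app s.1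

lemma cochainsMap_comm {F G : Simplex X ⥤ M} (φ : F ⟶ G) (k : ℕ) :
    cochainsMap φ k ≫ coboundary G k = coboundary F k ≫ cochainsMap φ (k + 1) := by
  refine biproduct.hom_ext' _ _ fun s => biproduct.hom_ext _ _ fun t => ?_
  simp [cochainsMap, coboundary, coboundaryEntry_naturality]

variable (X M) in
/-- The cellular cochain complex, as a functor. -/
def cellularComplexFunctor : (Simplex X ⥤ M) ⥤ CochainComplex M ℕ where
  obj F := cellularComplex F
  map {F G} φ := CochainComplex.ofHom (X := cellularComplex F) (Y := cellularComplex G)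
    (cochainsMap φ) fun k => by
      simpa [cellularComplex, CochainComplex.of.d] using cochainsMap_comm φ k
  map_id F := by
    ext k : 1
    exact biproduct.hom_ext _ _ fun t => by simp [cochainsMap, cellularComplex, cochains]
  map_comp {F G H} φ ψ := by
    ext k : 1
    exact biproduct.hom_ext _ _ fun t => by
      change cochainsMap (φ ≫ ψ) k ≫ biproduct.π (fun s : SimplexOfDim X k => H.obj s.1) t =
        (cochainsMap φ k ≫ cochainsMap ψ k) ≫ biproduct.π _ t
      simp [cochainsMap]

variable (X M) in
/-- The `k`-th cellular cohomology of a sheaf on `X`, as a functor. -/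
def cellularCohomology [IsGrothendieckAbelian.{u} M] (k : ℕ) : TopCat.Sheaf M (space X) ⥤ M :=
  toCellular X M ⋙ cellularComplexFunctor X M ⋙ HomologicalComplex.homologyFunctor M _ k

end Cellular

section Cech

/-- The category of open covers of a space. An object is a family of open sets with union
the whole space; a morphism `𝒱 ⟶ 𝒰` is a map `r` of the index sets such that
`𝒱 j ≤ 𝒰 (r j)` for all `j`, i.e. it exhibits `𝒱` as a refinement of `𝒰`. -/
abbrev Cover (T : TopCat.{u}) : Type (u + 1) :=
  ObjectProperty.FullSubcategory
    (fun 𝒰 : FormalCoproduct.{u} (Opens T) => ⨆ i, 𝒰.obj i = ⊤)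

/-- The nerve of an open cover. -/
def nerve {T : TopCat.{u}} (𝒰 : Cover T) : PreAbstractSimplicialComplex 𝒰.obj.I where
  faces := {s | s.Nonempty ∧ (⋂ i ∈ s, (𝒰.obj.obj i : Set T)).Nonempty}
  isRelLowerSet_faces := by
    rintro s ⟨hs, y, hy⟩
    refine ⟨hs, fun t hts ht => ⟨ht, y, ?_⟩⟩
    simp only [Set.mem_iInter] at hy ⊢
    exact fun i hi => hy i (hts hi)

variable (T : TopCat.{u}) (M : Type v) [Category.{u} M] [Abelian M] [IsGrothendieckAbelian.{u} M]

/-- The functor sending a family `𝒰` of open sets and a presheaf `ℱ` to the Čech complex of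
`ℱ` with respect to `𝒰`, whose `n`-cochains are `∏ ℱ(𝒰 i₀ ∩ ⋯ ∩ 𝒰 iₙ)`, the product being over
all tuples `(i₀, …, iₙ)` of indices. A refinement map `r` acts by pulling back cochains along
`(i₀, …, iₙ) ↦ (r i₀, …, r iₙ)` and restricting. -/
def cechComplex :
    (FormalCoproduct.{u} (Opens T))ᵒᵖ ⥤ TopCat.Presheaf M T ⥤ CochainComplex M ℕ :=
  FormalCoproduct.cechFunctor.op ⋙ (simplicialCosimplicialEquiv _).functor ⋙
    Functor.whiskeringLeft SimplexCategory (FormalCoproduct.{u} (Opens T))ᵒᵖ M ⋙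
    (Functor.whiskeringLeft _ _ _).obj (FormalCoproduct.evalOp.{u} (Opens T) M) ⋙
    (Functor.whiskeringRight _ _ _).obj (AlgebraicTopology.alternatingCofaceMapComplex M)

lemma cechComplex_obj (𝒰 : FormalCoproduct.{u} (Opens T)) :
    (cechComplex T M).obj (op 𝒰) = cechComplexFunctor 𝒰.obj := rfl

/-- The functor sending an open cover `𝒰` to the `k`-th Čech cohomology functor `Ȟᵏ(𝒰, -)`. -/
def cechDiagram (k : ℕ) : (Cover T)ᵒᵖ ⥤ (TopCat.Sheaf M T ⥤ M) :=
  (ObjectProperty.ι _).op ⋙ cechComplex T M ⋙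
    (Functor.whiskeringRight _ _ _).obj (HomologicalComplex.homologyFunctor M _ k) ⋙
    (Functor.whiskeringLeft _ _ _).obj (TopCat.Sheaf.forget M T)

end Cech

section Star

variable {V : Type u} (X : PreAbstractSimplicialComplex V)

/-- The cover of `X` by the open stars of its vertices. -/
def starCover : Cover (space X) where
  obj := ⟨Vertex X, fun x => Alexandrov.principalOpen x.simplex⟩
  property := by
    refine top_unique fun s _ => ?_
    obtain ⟨x, hx⟩ := s.verts_nonempty
    have hm : {x} ∈ X := (X.isRelLowerSet_faces s.verts_mem).2
      (Finset.singleton_subset_iff.2 hx) (Finset.singleton_nonempty x)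
    exact Opens.mem_iSup.2 ⟨⟨x, hm⟩, Finset.singleton_subset_iff.2 hx⟩

end Star

end

end SimplicialSheaf

namespace SimplicialSheaf

noncomputable section

/-! ### Functorial injective embeddings and derived functors -/

section Comparison

universe v₁ u₁ v₂ u₂

section ToHomology

variable {B : Type u₂} [Category.{v₂} B] [Abelian B]

/-- The class map from an object mapping to the cocycles. -/
def toHomology (K : CochainComplex B ℕ) {n : ℕ} {Y : B} (i : Y ⟶ K.X n)
    (hi : i ≫ K.d n (n + 1) = 0) : Y ⟶ K.homology n :=
  K.liftCycles i (n + 1) (by simp) hi ≫ K.homologyπ n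

lemma toHomology_naturality {K L : CochainComplex B ℕ} (f : K ⟶ L) {n : ℕ} {Y Z : B}
    (i : Y ⟶ K.X n) (hi : i ≫ K.d n (n + 1) = 0) (j : Z ⟶ L.X n) (hj : j ≫ L.d n (n + 1) = 0)
    (y : Y ⟶ Z) (h : y ≫ j = i ≫ f.f n) :
    y ≫ toHomology L j hj = toHomology K i hi ≫ HomologicalComplex.homologyMap f n := by
  have : y ≫ L.liftCycles j (n + 1) (by simp) hj =
      K.liftCycles i (n + 1) (by simp) hi ≫ HomologicalComplex.cyclesMap f n := by
    rw [← cancel_mono (L.iCycles n)]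
    simp [h]
  simp [toHomology, reassoc_of% this]

lemma isIso_liftCycles (K : CochainComplex B ℕ) {n : ℕ} {Y : B} (i : Y ⟶ K.X n)
    (hi : i ≫ K.d n (n + 1) = 0) (h : (ShortComplex.mk _ _ hi).Exact) (hm : Mono i) :
    IsIso (K.liftCycles i (n + 1) (by simp) hi) := by
  have : Mono (ShortComplex.mk _ _ hi).f := hm
  have hm' : Mono (K.liftCycles i (n + 1) (by simp) hi) := by
    have : Mono (K.liftCycles i (n + 1) (by simp) hi ≫ K.iCycles n) := by
      rw [HomologicalComplex.liftCycles_i]; exact hm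
    exact mono_of_mono _ (K.iCycles n)
  let l : K.cycles n ⟶ Y := h.lift (K.iCycles n) (K.iCycles_d n (n + 1))
  have hl : l ≫ i = K.iCycles n := h.lift_f _ _
  have : l ≫ K.liftCycles i (n + 1) (by simp) hi = 𝟙 _ := by
    rw [← cancel_mono (K.iCycles n), Category.assoc, HomologicalComplex.liftCycles_i, hl,
      Category.id_comp]
  have hs : IsSplitEpi (K.liftCycles i (n + 1) (by simp) hi) := ⟨⟨l, this⟩⟩
  exact isIso_of_mono_of_isSplitEpi _

lemma isIso_toHomology_zero (K : CochainComplex B ℕ) {Y : B} (i : Y ⟶ K.X 0)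
    (hi : i ≫ K.d 0 1 = 0) (h : (ShortComplex.mk _ _ hi).Exact) (hm : Mono i) :
    IsIso (toHomology K i hi) := by
  have := isIso_liftCycles K i hi h hm
  have : IsIso (K.homologyπ 0) := inferInstanceAs (IsIso (CochainComplex.isoHomologyπ₀ K).hom)
  exact IsIso.comp_isIso

lemma exact_toHomology (K : CochainComplex B ℕ) {n : ℕ} {Y : B} (p : K.X n ⟶ Y)
    (i : Y ⟶ K.X (n + 1)) (hi : i ≫ K.d (n + 1) (n + 1 + 1) = 0) (hpi : p ≫ i = K.d n (n + 1))
    (h : (ShortComplex.mk _ _ hi).Exact) (hm : Mono i) :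
    ∃ w : p ≫ toHomology K i hi = 0,
      (ShortComplex.mk _ _ w).Exact ∧ Epi (toHomology K i hi) := by
  have hiso := isIso_liftCycles K i hi h hm
  have hp : p ≫ K.liftCycles i (n + 1 + 1) (by simp) hi = K.toCycles n (n + 1) := by
    rw [← cancel_mono (K.iCycles (n + 1))]
    simp [hpi]
  have w : p ≫ toHomology K i hi = 0 := by
    rw [toHomology, reassoc_of% hp, HomologicalComplex.toCycles_comp_homologyπ]
  refine ⟨w, ShortComplex.exact_of_iso ?_ (ShortComplex.exact_of_g_is_cokernel
    (ShortComplex.mk _ _ (K.toCycles_comp_homologyπ n (n + 1)))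
    (K.homologyIsCokernel n (n + 1) (CochainComplex.prev_nat_succ n))), epi_comp _ _⟩
  refine ShortComplex.isoMk (Iso.refl _)
    (@asIso _ _ _ _ _ hiso).symm (Iso.refl _) ?_ ?_
  · simp [← hp]
  · simp [toHomology]

lemma exact_epi_of_iso {X₁ X₂ X₃ Y₁ Y₂ Y₃ : B} {f : X₁ ⟶ X₂} {g : X₂ ⟶ X₃} {f' : Y₁ ⟶ Y₂}
    {g' : Y₂ ⟶ Y₃} {w' : f' ≫ g' = 0} (h : (ShortComplex.mk _ _ w').Exact) (he : Epi g')
    (e₁ : X₁ ≅ Y₁) (e₂ : X₂ ≅ Y₂) (e₃ : Y₃ ≅ X₃) (hf : f ≫ e₂.hom = e₁.hom ≫ f')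
    (hg : g = e₂.hom ≫ g' ≫ e₃.hom) :
    ∃ w : f ≫ g = 0, (ShortComplex.mk _ _ w).Exact ∧ Epi g := by
  have w : f ≫ g = 0 := by rw [hg, reassoc_of% hf, reassoc_of% w', zero_comp, comp_zero]
  refine ⟨w, ShortComplex.exact_of_iso (ShortComplex.isoMk e₁.symm e₂.symm e₃ ?_ ?_) h, ?_⟩
  · dsimp
    rw [Iso.inv_comp_eq, ← Category.assoc, ← hf, Category.assoc, e₂.hom_inv_id, Category.comp_id]
  · simp [hg]
  · rw [hg]
    infer_instance

lemma nonempty_iso_of_isCokernel {A : Type u₁} [Category.{v₁} A] {X₁ X₂ X₃ X₃' : A ⥤ B}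
    (a : X₁ ⟶ X₂) (b : X₂ ⟶ X₃) (b' : X₂ ⟶ X₃')
    (h : ∀ F, ∃ w : a.app F ≫ b.app F = 0, (ShortComplex.mk _ _ w).Exact ∧ Epi (b.app F))
    (h' : ∀ F, ∃ w : a.app F ≫ b'.app F = 0, (ShortComplex.mk _ _ w).Exact ∧ Epi (b'.app F)) :
    Nonempty (X₃ ≅ X₃') := by
  have e (F : A) : ∃ i : X₃.obj F ≅ X₃'.obj F, b.app F ≫ i.hom = b'.app F := by
    obtain ⟨w, hw, he⟩ := h F
    obtain ⟨w', hw', he'⟩ := h' F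
    exact ⟨hw.gIsCokernel.coconePointUniqueUpToIso hw'.gIsCokernel,
      hw.gIsCokernel.comp_coconePointUniqueUpToIso_hom _ WalkingParallelPair.one⟩
  choose i hi using e
  refine ⟨NatIso.ofComponents i fun {F G} f => ?_⟩
  have := (h F).choose_spec.2
  rw [← cancel_epi (b.app F), ← b.naturality_assoc, hi, b'.naturality, ← Category.assoc, hi]

end ToHomology

/-- A functorial embedding `ι : F ⟶ J F` into injective objects, with cokernel `π : J F ⟶ Q F`. -/
structure InjectiveEmbedding (A : Type u₁) [Category.{v₁} A] [Abelian A] where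
  /-- the injective object -/
  J : A ⥤ A
  /-- the cokernel of the embedding -/
  Q : A ⥤ A
  /-- the embedding -/
  ι : 𝟭 A ⟶ J
  /-- the projection to the cokernel -/
  π : J ⟶ Q
  w (F : A) : ι.app F ≫ π.app F = 0
  shortExact (F : A) : (ShortComplex.mk (ι.app F) (π.app F) (w F)).ShortExact
  injective (F : A) : Injective (J.obj F)

/-- Every Grothendieck abelian category has a functorial embedding into injectives. -/
lemma nonempty_injectiveEmbedding (A : Type u₁) [Category.{v₁} A] [Abelian A]
    [IsGrothendieckAbelian.{v₂} A] : Nonempty (InjectiveEmbedding A) := by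
  open ZeroObject in
  let D := MorphismProperty.functorialFactorizationData
    (MorphismProperty.monomorphisms A) (MorphismProperty.monomorphisms A).rlp
  let Z : A ⥤ Arrow A :=
    { obj F := Arrow.mk (0 : F ⟶ 0)
      map f := Arrow.homMk f (𝟙 _) (by simp)
      map_id _ := by ext <;> simp
      map_comp _ _ := by ext <;> simp }
  let ι : 𝟭 A ⟶ Z ⋙ D.Z := Functor.whiskerLeft Z D.i
  have hι : ∀ F, Mono (ι.app F) := fun F => D.hi (Z.obj F)
  have : Mono ι := NatTrans.mono_of_mono_app ι
  let S : ShortComplex (A ⥤ A) := ShortComplex.mk ι (cokernel.π ι) (cokernel.condition ι)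
  have hS : S.ShortExact :=
    { exact := ShortComplex.exact_cokernel ι
      mono_f := this
      epi_g := inferInstanceAs (Epi (cokernel.π ι)) }
  exact ⟨{
    J := Z ⋙ D.Z
    Q := cokernel ι
    ι := ι
    π := cokernel.π ι
    w := fun F => (S.map ((evaluation A A).obj F)).zero
    shortExact := fun F => hS.map_of_exact ((evaluation A A).obj F)
    injective := fun F => by
      rw [injective_iff_rlp_monomorphisms_zero]
      have := D.hp (Z.obj F)
      rwa [(isZero_zero A).eq_of_tgt (D.p.app (Z.obj F)) 0] at this }⟩

namespace InjectiveEmbedding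

variable {A : Type u₁} [Category.{v₁} A] [Abelian A] (E : InjectiveEmbedding A)

/-- The embedding sequences, as a functor to short complexes. -/
@[simps]
def sequence : A ⥤ ShortComplex A where
  obj F := ShortComplex.mk (E.ι.app F) (E.π.app F) (E.w F)
  map f := ⟨f, E.J.map f, E.Q.map f, E.ι.naturality f, E.π.naturality f⟩

/-- The iterated cosyzygy functors. -/
def iter : ℕ → A ⥤ A
  | 0 => 𝟭 A
  | n + 1 => iter n ⋙ E.Q

lemma d_naturality {F G : A} (f : F ⟶ G) :
    E.J.map f ≫ E.π.app G ≫ E.ι.app (E.Q.obj G) =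
      (E.π.app F ≫ E.ι.app (E.Q.obj F)) ≫ E.J.map (E.Q.map f) := by
  have := E.ι.naturality (E.Q.map f)
  dsimp at this
  rw [Category.assoc, ← this, E.π.naturality_assoc]

lemma ι_comp_d (F : A) : E.ι.app F ≫ E.π.app F ≫ E.ι.app (E.Q.obj F) = 0 := by
  rw [← Category.assoc, E.w, zero_comp]

lemma exact_π_ι (F : A) : (ShortComplex.mk (E.ι.app F) (E.π.app F ≫ E.ι.app (E.Q.obj F))
    (E.ι_comp_d _)).Exact := by
  have := (E.shortExact (E.Q.obj F)).mono_f
  let α : ShortComplex.mk (E.ι.app F) (E.π.app F) (E.w F) ⟶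
      ShortComplex.mk (E.ι.app F) (E.π.app F ≫ E.ι.app (E.Q.obj F))
        (E.ι_comp_d _) :=
    { τ₁ := 𝟙 _
      τ₂ := 𝟙 _
      τ₃ := E.ι.app (E.Q.obj F) }
  have h1 : Epi α.τ₁ := inferInstanceAs (Epi (𝟙 _))
  have h2 : IsIso α.τ₂ := inferInstanceAs (IsIso (𝟙 _))
  have h3 : Mono α.τ₃ := this
  rw [← ShortComplex.exact_iff_of_epi_of_isIso_of_mono α]
  exact (E.shortExact F).exact

lemma d_comp_d (F : A) : (E.π.app F ≫ E.ι.app (E.Q.obj F)) ≫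
    E.π.app (E.Q.obj F) ≫ E.ι.app (E.Q.obj (E.Q.obj F)) = 0 := by
  rw [Category.assoc, ← Category.assoc (E.ι.app _), E.w, zero_comp, comp_zero]

lemma exact_d_d (F : A) : (ShortComplex.mk (E.π.app F ≫ E.ι.app (E.Q.obj F))
    (E.π.app (E.Q.obj F) ≫ E.ι.app (E.Q.obj (E.Q.obj F))) (E.d_comp_d F)).Exact := by
  have := (E.shortExact F).epi_g
  let α : ShortComplex.mk (E.π.app F ≫ E.ι.app (E.Q.obj F))
      (E.π.app (E.Q.obj F) ≫ E.ι.app (E.Q.obj (E.Q.obj F))) (E.d_comp_d F) ⟶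
      ShortComplex.mk (E.ι.app (E.Q.obj F))
        (E.π.app (E.Q.obj F) ≫ E.ι.app (E.Q.obj (E.Q.obj F)))
        (E.ι_comp_d _) :=
    { τ₁ := E.π.app F
      τ₂ := 𝟙 _
      τ₃ := 𝟙 _ }
  have h1 : Epi α.τ₁ := this
  have h2 : IsIso α.τ₂ := inferInstanceAs (IsIso (𝟙 _))
  have h3 : Mono α.τ₃ := inferInstanceAs (Mono (𝟙 _))
  rw [ShortComplex.exact_iff_of_epi_of_isIso_of_mono α]
  exact E.exact_π_ι (E.Q.obj F)

/-- The functorial injective resolution. -/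
def resolutionComplex (F : A) : CochainComplex A ℕ :=
  CochainComplex.of (fun n => E.J.obj ((E.iter n).obj F))
    (fun n => E.π.app _ ≫ E.ι.app (E.Q.obj ((E.iter n).obj F)))
    (fun n => E.d_comp_d ((E.iter n).obj F))

lemma resolutionComplex_d (F : A) (n : ℕ) : (E.resolutionComplex F).d n (n + 1) =
    E.π.app _ ≫ E.ι.app (E.Q.obj ((E.iter n).obj F)) :=
  CochainComplex.of_d (fun n => E.J.obj ((E.iter n).obj F))
    (fun n => E.π.app _ ≫ E.ι.app (E.Q.obj ((E.iter n).obj F))) n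

/-- The functorial injective resolution, as a functor. -/
def resolutionFunctor : A ⥤ CochainComplex A ℕ where
  obj F := E.resolutionComplex F
  map {F G} f := CochainComplex.ofHom (X := E.resolutionComplex F) (Y := E.resolutionComplex G)
    (fun n => E.J.map ((E.iter n).map f)) fun n => by
      refine (congrArg (_ ≫ ·) (E.resolutionComplex_d G n)).trans (Eq.trans ?_
        (congrArg (· ≫ _) (E.resolutionComplex_d F n)).symm)
      exact E.d_naturality ((E.iter n).map f)
  map_id F := by
    ext n
    simp [resolutionComplex]
  map_comp f g := by
    ext n
    exact (congrArg E.J.map ((E.iter n).map_comp f g)).trans (E.J.map_comp _ _)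

lemma resolutionComplex_exactAt (F : A) (n : ℕ) : (E.resolutionComplex F).ExactAt (n + 1) := by
  rw [HomologicalComplex.exactAt_iff' _ n (n + 1) (n + 1 + 1) (by simp) (by simp)]
  refine ShortComplex.exact_of_iso ?_ (E.exact_d_d ((E.iter n).obj F))
  exact ShortComplex.isoMk (Iso.refl _) (Iso.refl _) (Iso.refl _)
    ((Category.id_comp _).trans ((E.resolutionComplex_d F n).trans (Category.comp_id _).symm))
    ((Category.id_comp _).trans ((E.resolutionComplex_d F (n + 1)).trans (Category.comp_id _).symm))

/-- The augmentation of the functorial injective resolution. -/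
def toResolution (F : A) : (CochainComplex.single₀ A).obj F ⟶ E.resolutionComplex F :=
  (CochainComplex.fromSingle₀Equiv _ _).symm ⟨E.ι.app F,
    (congrArg (_ ≫ ·) (E.resolutionComplex_d F 0)).trans (E.ι_comp_d F)⟩

lemma toResolution_f_zero (F : A) : (E.toResolution F).f 0 = E.ι.app F :=
  CochainComplex.fromSingle₀Equiv_symm_apply_f_zero (C := E.resolutionComplex F) _ _

/-- The injective resolution of an object. -/
def resolution (F : A) : InjectiveResolution F where
  cocomplex := E.resolutionComplex F
  injective n := E.injective _
  ι := E.toResolution F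
  quasiIso := ⟨fun n => by
    cases n
    · rw [CochainComplex.quasiIsoAt₀_iff, ShortComplex.quasiIso_iff_of_zeros]
      · refine (ShortComplex.exact_and_mono_f_iff_of_iso ?_).2
          ⟨E.exact_π_ι F, (E.shortExact F).mono_f⟩
        exact ShortComplex.isoMk (Iso.refl _) (Iso.refl _) (Iso.refl _)
          ((Category.id_comp _).trans ((E.toResolution_f_zero F).symm.trans
            (Category.comp_id _).symm))
          ((Category.id_comp _).trans ((E.resolutionComplex_d F 0).symm.trans
            (Category.comp_id _).symm))
      all_goals rfl
    · rw [quasiIsoAt_iff_exactAt]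
      · apply resolutionComplex_exactAt
      · apply CochainComplex.exactAt_succ_single_obj⟩

variable {B : Type u₂} [Category.{v₂} B] [Abelian B]

/-- The derived functors are computed by the functorial injective resolution. -/
def rightDerivedIso [HasInjectiveResolutions A] (Γ : A ⥤ B) [Γ.Additive] (n : ℕ) :
    Γ.rightDerived n ≅ E.resolutionFunctor ⋙ Γ.mapHomologicalComplex _ ⋙
      HomologicalComplex.homologyFunctor B _ n :=
  NatIso.ofComponents (fun F => (E.resolution F).isoRightDerivedObj Γ n) fun {F G} f =>
    InjectiveResolution.isoRightDerivedObj_hom_naturality f (E.resolution F) (E.resolution G)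
      (E.resolutionFunctor.map f) ((congrArg (· ≫ _)
        (E.toResolution_f_zero F)).trans ((E.ι.naturality f).symm.trans (congrArg (_ ≫ ·)
          (E.toResolution_f_zero G).symm))) Γ n

/-- The functorial injective resolution, after applying a functor. -/
abbrev mapResolution (Γ : A ⥤ B) [Γ.Additive] : A ⥤ CochainComplex B ℕ :=
  E.resolutionFunctor ⋙ Γ.mapHomologicalComplex _

lemma mapResolution_d (Γ : A ⥤ B) [Γ.Additive] (F : A) (n : ℕ) :
    ((E.mapResolution Γ).obj F).d n (n + 1) =
      Γ.map (E.π.app _ ≫ E.ι.app (E.Q.obj ((E.iter n).obj F))) :=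
  congrArg Γ.map (E.resolutionComplex_d F n)

/-- The map from `Γ (Qⁿ F)` to the complex computing the derived functors of `Γ`. -/
def toMapResolution (Γ : A ⥤ B) [Γ.Additive] (F : A) (n : ℕ) :
    Γ.obj ((E.iter n).obj F) ⟶ ((E.mapResolution Γ).obj F).X n :=
  Γ.map (E.ι.app ((E.iter n).obj F))

lemma toMapResolution_d (Γ : A ⥤ B) [Γ.Additive] (F : A) (n : ℕ) :
    E.toMapResolution Γ F n ≫ ((E.mapResolution Γ).obj F).d n (n + 1) = 0 := by
  refine (congrArg (_ ≫ ·) (E.mapResolution_d Γ F n)).trans ?_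
  refine (Γ.map_comp _ _).symm.trans ?_
  exact (congrArg Γ.map (E.ι_comp_d _)).trans (Γ.map_zero _ _)

/-- The projection from `Γ (Qⁿ F)` to the cohomology of the resolution. -/
def toResolutionHomology (Γ : A ⥤ B) [Γ.Additive] (n : ℕ) :
    E.iter n ⋙ Γ ⟶ E.mapResolution Γ ⋙ HomologicalComplex.homologyFunctor B _ n where
  app F := toHomology _ (E.toMapResolution Γ F n) (E.toMapResolution_d Γ F n)
  naturality _ _ f := toHomology_naturality ((E.mapResolution Γ).map f) _ _ _ _
    (Γ.map ((E.iter n).map f)) ((Γ.map_comp _ _).symm.trans (Eq.trans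
      (congrArg Γ.map (E.ι.naturality ((E.iter n).map f))) (Γ.map_comp _ _)))

lemma exact_toResolutionHomology (Γ : A ⥤ B) [Γ.Additive] [PreservesFiniteLimits Γ] (n : ℕ)
    (F : A) : ∃ w : (Functor.whiskerRight (Functor.whiskerLeft (E.iter n) E.π) Γ).app F ≫
      (E.toResolutionHomology Γ (n + 1)).app F = 0,
      (ShortComplex.mk _ _ w).Exact ∧ Epi ((E.toResolutionHomology Γ (n + 1)).app F) := by
  have hmono : Mono (E.ι.app ((E.iter (n + 1)).obj F)) :=
    (E.shortExact ((E.iter (n + 1)).obj F)).mono_f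
  have hmono' : Mono (Γ.map (E.ι.app ((E.iter (n + 1)).obj F))) := inferInstance
  have hk := (E.exact_π_ι ((E.iter (n + 1)).obj F)).map_of_mono_of_preservesKernel Γ hmono
    inferInstance
  refine exact_toHomology ((E.mapResolution Γ).obj F) (Γ.map (E.π.app ((E.iter n).obj F)))
    (E.toMapResolution Γ F (n + 1)) (E.toMapResolution_d Γ F (n + 1))
    ((Γ.map_comp _ _).symm.trans (E.mapResolution_d Γ F n).symm) ?_ hmono'
  refine ShortComplex.exact_of_iso ?_ hk
  exact ShortComplex.isoMk (Iso.refl _) (Iso.refl _) (Iso.refl _)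
    ((Category.id_comp _).trans (Category.comp_id _).symm)
    ((Category.id_comp _).trans ((E.mapResolution_d Γ F (n + 1)).trans (Category.comp_id _).symm))

section Effaceable

variable (C : A ⥤ CochainComplex B ℕ) [C.PreservesZeroMorphisms]
  (hC : ∀ S : ShortComplex A, S.ShortExact → (S.map C).ShortExact)

include hC in
lemma map_shortExact (F : A) : ((E.sequence.obj F).map C).ShortExact := hC _ (E.shortExact F)

/-- The connecting homomorphism, as a natural transformation. -/
def connecting (n : ℕ) : E.Q ⋙ C ⋙ HomologicalComplex.homologyFunctor B _ n ⟶
    C ⋙ HomologicalComplex.homologyFunctor B _ (n + 1) where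
  app F := (E.map_shortExact C hC F).δ n (n + 1) (by simp)
  naturality F G f :=
    (HomologicalComplex.HomologySequence.δ_naturality (C.mapShortComplex.map (E.sequence.map f))
      (E.map_shortExact C hC F) (E.map_shortExact C hC G) n (n + 1) (by simp)).symm

variable (hI : ∀ (I : A) [Injective I] (n : ℕ), (C.obj I).ExactAt (n + 1))

include hC hI in
lemma nonempty_iter_iso (n : ℕ) : ∀ m k : ℕ, m + n = k →
    Nonempty (E.iter n ⋙ C ⋙ HomologicalComplex.homologyFunctor B _ (m + 1) ≅
      C ⋙ HomologicalComplex.homologyFunctor B _ (k + 1)) := by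
  induction n with
  | zero =>
    rintro m _ rfl
    exact ⟨Functor.leftUnitor _⟩
  | succ n ih =>
    intro m k hk
    have hz (F : A) (i : ℕ) : IsZero ((C.obj (E.J.obj F)).homology (i + 1)) := by
      have := E.injective F
      exact (HomologicalComplex.exactAt_iff_isZero_homology _ _).1 (hI _ i)
    have (F : A) : IsIso ((E.connecting C hC (m + 1)).app F) :=
      (E.map_shortExact C hC F).isIso_δ _ _ (by simp) (hz F m) (hz F (m + 1))
    have : IsIso (E.connecting C hC (m + 1)) := NatIso.isIso_of_isIso_app _
    obtain ⟨e⟩ := ih (m + 1) k (by omega)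
    exact ⟨Functor.associator _ _ _ ≪≫
      Functor.isoWhiskerLeft (E.iter n) (asIso (E.connecting C hC (m + 1))) ≪≫ e⟩

end Effaceable

end InjectiveEmbedding

variable {A : Type u₁} [Category.{v₁} A] [Abelian A] {B : Type u₂} [Category.{v₂} B] [Abelian B]

/-- An exact functor `C` to cochain complexes computes the derived functors of its cohomology `Γ`
in degree zero, if its higher cohomology vanishes on injective objects. -/
theorem nonempty_rightDerived_iso [HasInjectiveResolutions A] (E : InjectiveEmbedding A)
    (Γ : A ⥤ B) [Γ.Additive] [PreservesFiniteLimits Γ]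
    (C : A ⥤ CochainComplex B ℕ) [C.PreservesZeroMorphisms]
    (hC : ∀ S : ShortComplex A, S.ShortExact → (S.map C).ShortExact)
    (hI : ∀ (I : A) [Injective I] (n : ℕ), (C.obj I).ExactAt (n + 1))
    (a : Γ ⟶ C ⋙ HomologicalComplex.eval B _ 0)
    (ha : ∀ F, a.app F ≫ (C.obj F).d 0 1 = 0)
    (hk : ∀ F, (ShortComplex.mk _ _ (ha F)).Exact ∧ Mono (a.app F)) (n : ℕ) :
    Nonempty (Γ.rightDerived n ≅ C ⋙ HomologicalComplex.homologyFunctor B _ n) := by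
  have hc (F : A) : IsIso (toHomology (C.obj F) (a.app F) (ha F)) :=
    isIso_toHomology_zero _ _ _ (hk F).1 (hk F).2
  let e : Γ ≅ C ⋙ HomologicalComplex.homologyFunctor B _ 0 :=
    NatIso.ofComponents (fun F => @asIso _ _ _ _ (toHomology (C.obj F) (a.app F) (ha F)) (hc F)) fun {F G} f =>
      toHomology_naturality _ _ _ _ _ _ (a.naturality f)
  obtain _ | n := n
  · exact ⟨Γ.rightDerivedZeroIsoSelf ≪≫ e⟩
  obtain ⟨s⟩ := E.nonempty_iter_iso C hC hI n 0 n (by simp)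
  let b : E.iter (n + 1) ⋙ Γ ⟶ C ⋙ HomologicalComplex.homologyFunctor B _ (n + 1) :=
    Functor.whiskerLeft (E.iter (n + 1)) e.hom ≫
      Functor.whiskerLeft (E.iter n) (E.connecting C hC 0) ≫ s.hom
  obtain ⟨t⟩ := nonempty_iso_of_isCokernel
    (Functor.whiskerRight (Functor.whiskerLeft (E.iter n) E.π) Γ) (E.toResolutionHomology Γ (n + 1))
    b (E.exact_toResolutionHomology Γ n) (fun F => by
      have hz : IsZero ((C.obj (E.J.obj ((E.iter n).obj F))).homology 1) := by
        have := E.injective ((E.iter n).obj F)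
        exact (HomologicalComplex.exactAt_iff_isZero_homology _ _).1 (hI _ 0)
      have hS := E.map_shortExact C hC ((E.iter n).obj F)
      have hepi : Epi (hS.δ 0 1 (by simp)) := hS.epi_δ _ _ (by simp) hz
      exact exact_epi_of_iso (hS.homology_exact₃ 0 1 (by simp)) hepi (e.app _) (e.app _) (s.app F)
        (e.hom.naturality (E.π.app ((E.iter n).obj F))) rfl)
  exact ⟨E.rightDerivedIso Γ (n + 1) ≪≫ t⟩

end Comparison

/-! ### Sheaves and functors on the face poset -/

section Sheaves

variable {V : Type u} (X : PreAbstractSimplicialComplex V)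

lemma toCellular_isEquivalence (M : Type v) [Category.{u} M] [Abelian M]
    [IsGrothendieckAbelian.{u} M] : (toCellular X M).IsEquivalence := by
  have h1 : (Functor.sheafPushforwardContinuous (minNhds (Simplex X)) M ⊥
      (Opens.grothendieckTopology (space X))).IsEquivalence := inferInstance
  have h2 : (sheafToPresheaf (⊥ : GrothendieckTopology (Simplex X)ᵒᵖ) M).IsEquivalence :=
    (sheafBotEquivalence M).isEquivalence_functor
  have h3 : ((Functor.whiskeringLeft _ _ M).obj (opOp (Simplex X))).IsEquivalence := inferInstance
  exact inferInstanceAs ((Functor.sheafPushforwardContinuous (minNhds (Simplex X)) M ⊥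
      (Opens.grothendieckTopology (space X)) ⋙ sheafToPresheaf _ M ⋙
      (Functor.whiskeringLeft _ _ M).obj (opOp (Simplex X))).IsEquivalence)

instance (M : Type v) [Category.{u} M] [Abelian M]
    [IsGrothendieckAbelian.{u} M] : PreservesFiniteLimits (globalSections X M) := by
  have : PreservesFiniteLimits (TopCat.Sheaf.forget M (space X)) :=
    inferInstanceAs (PreservesFiniteLimits (sheafToPresheaf _ M))
  have : PreservesFiniteLimits ((evaluation (Opens (space X))ᵒᵖ M).obj (op ⊤)) := inferInstance
  exact comp_preservesFiniteLimits _ _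

lemma map_nerve_starCover [DecidableEq V] :
    (nerve (starCover X)).map (fun x : Vertex X => x.1) = X := by
  refine SetLike.ext fun s => ?_
  constructor
  · rintro ⟨t, ⟨ht, y, hy⟩, rfl⟩
    refine (X.isRelLowerSet_faces y.verts_mem).2 (fun x hx => ?_) (ht.image _)
    obtain ⟨w, hw, rfl⟩ := Finset.mem_image.1 hx
    have := Set.mem_iInter₂.1 hy w hw
    exact Finset.singleton_subset_iff.1 this
  · intro hs
    have hv (x : s) : {x.1} ∈ X := (X.isRelLowerSet_faces hs).2
      (Finset.singleton_subset_iff.2 x.2) (Finset.singleton_nonempty _)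
    let e : s ↪ Vertex X := ⟨fun x => ⟨x.1, hv x⟩, fun x y h => Subtype.ext (congrArg (·.1) h)⟩
    refine ⟨s.attach.map e, ⟨?_, ⟨s, hs⟩, ?_⟩, ?_⟩
    · exact Finset.map_nonempty.2 (Finset.attach_nonempty_iff.2 (X.isRelLowerSet_faces hs).1)
    · refine Set.mem_iInter₂.2 fun w hw => ?_
      obtain ⟨x, -, rfl⟩ := Finset.mem_map.1 hw
      exact Finset.singleton_subset_iff.2 x.2
    · ext x
      refine Finset.mem_image.trans ⟨?_, fun hx => ⟨e ⟨x, hx⟩, Finset.mem_map.2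
        ⟨_, Finset.mem_attach _ _, rfl⟩, rfl⟩⟩
      rintro ⟨w, hw, rfl⟩
      obtain ⟨x, -, rfl⟩ := Finset.mem_map.1 hw
      exact x.2

lemma nonempty_starCover_hom (𝒰 : Cover (space X)) : Nonempty (starCover X ⟶ 𝒰) := by
  have h (x : Vertex X) : ∃ i, x.simplex ∈ 𝒰.obj.obj i := by
    rw [← Opens.mem_iSup, 𝒰.property]
    trivial
  choose r hr using h
  exact ⟨ObjectProperty.homMk ⟨r, fun x => homOfLE ((Alexandrov.principalOpen_le_iff _).2 (hr x))⟩⟩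

end Sheaves

section Gluing

variable {T : TopCat.{u}} {M : Type v} [Category.{u} M]

/-- Morphisms to the sections of a sheaf can be glued. -/
lemma existsUnique_glue_hom (F : TopCat.Sheaf M T) {ι : Type u} (U : ι → Opens T) (E : M)
    (z : ∀ i, E ⟶ F.presheaf.obj (op (U i)))
    (hz : ∀ i j, z i ≫ F.presheaf.map (Opens.infLELeft (U i) (U j)).op =
      z j ≫ F.presheaf.map (Opens.infLERight (U i) (U j)).op) :
    ∃! s : E ⟶ F.presheaf.obj (op (iSup U)), ∀ i, s ≫ F.presheaf.map (Opens.leSupr U i).op = z i :=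
  TopCat.Presheaf.IsSheaf.isSheafUniqueGluing_types
    (F := F.presheaf ⋙ coyoneda.obj (op E)) (U := U)
    ((isSheaf_iff_isSheaf_of_type _ _).2 (F.property E)) z hz

end Gluing

/-! ### Godement sheaves -/

section Godement

variable {T : TopCat.{u}} {M : Type v} [Category.{u} M] [HasProducts.{u} M] (A : T → M)

/-- The presheaf with sections `∏ A p` over `U`, the product being over all points `p` of `U`. -/
def godementPresheaf : TopCat.Presheaf M T where
  obj U := ∏ᶜ fun p : U.unop => A p
  map f := Pi.lift fun p => Pi.π _ (f.unop p)
  map_id U := by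
    refine Pi.hom_ext _ _ fun p => ?_
    rw [Pi.lift_π, Category.id_comp]
    rfl
  map_comp f g := by
    refine Pi.hom_ext _ _ fun p => ?_
    rw [Pi.lift_π, Category.assoc, Pi.lift_π, Pi.lift_π]
    rfl

variable {A} in
/-- The component of a section of the Godement presheaf at a point. -/
def godementπ {U : (Opens T)ᵒᵖ} (p : T) (hp : p ∈ U.unop) : (godementPresheaf A).obj U ⟶ A p :=
  Pi.π (fun p : U.unop => A p) ⟨p, hp⟩

variable {A} in
@[simp]
lemma godementPresheaf_map_π {U W : (Opens T)ᵒᵖ} (f : U ⟶ W) (p : T) (hp : p ∈ W.unop) :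
    (godementPresheaf A).map f ≫ godementπ p hp = godementπ p (f.unop.le hp) :=
  Pi.lift_π _ _

variable {A} in
lemma godement_hom_ext {E : M} {U : (Opens T)ᵒᵖ} {f g : E ⟶ (godementPresheaf A).obj U}
    (h : ∀ p hp, f ≫ godementπ p hp = g ≫ godementπ p hp) : f = g :=
  Pi.hom_ext _ _ fun p => h p.1 p.2

variable {A} in
/-- A morphism to the sections of the Godement presheaf. -/
def godementLift {E : M} {U : (Opens T)ᵒᵖ} (f : ∀ p ∈ U.unop, E ⟶ A p) :
    E ⟶ (godementPresheaf A).obj U :=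
  Pi.lift fun p => f p.1 p.2

variable {A} in
@[simp]
lemma godementLift_π {E : M} {U : (Opens T)ᵒᵖ} (f : ∀ p ∈ U.unop, E ⟶ A p) (p : T)
    (hp : p ∈ U.unop) : godementLift f ≫ godementπ p hp = f p hp :=
  Pi.lift_π _ _

/-- The Godement sheaf. -/
def godement : TopCat.Sheaf M T where
  obj := godementPresheaf A
  property := fun E => by
    rw [← isSheaf_iff_isSheaf_of_type]
    refine TopCat.Presheaf.isSheaf_of_iso (X := T) ?_
      (TopCat.Presheaf.toTypes_isSheaf T fun p => E ⟶ A p)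
    refine NatIso.ofComponents (fun U => Equiv.toIso
      { toFun := fun f => godementLift fun p hp => f ⟨p, hp⟩
        invFun := fun f p => f ≫ godementπ p.1 p.2
        left_inv := fun f => by
          funext p
          simp
        right_inv := fun f => godement_hom_ext fun p hp => by simp }) ?_
    intro U W f
    ext g
    refine godement_hom_ext fun p hp => ?_
    change godementLift (fun p hp => g ⟨p, f.unop.le hp⟩) ≫ godementπ p hp =
      (godementLift (fun p hp => g ⟨p, hp⟩) ≫ (godementPresheaf A).map f) ≫ godementπ p hp
    rw [Category.assoc, godementPresheaf_map_π, godementLift_π, godementLift_π]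

end Godement

section Embedding

variable {V : Type u} (X : PreAbstractSimplicialComplex V) {M : Type v} [Category.{u} M] [Abelian M]
    [IsGrothendieckAbelian.{u} M]

/-- The embedding of a sheaf into a Godement sheaf. -/
def toGodement (F : TopCat.Sheaf M (space X)) :
    F ⟶ godement fun p : space X => ((toCellular X M).obj F).obj p where
  hom :=
    { app U := godementLift fun p hp =>
        F.presheaf.map (homOfLE ((Alexandrov.principalOpen_le_iff _).2 hp)).op
      naturality U W f := godement_hom_ext fun p hp => by
        refine (Category.assoc _ _ _).trans ?_
        refine (congrArg (_ ≫ ·) (godementLift_π _ _ _)).trans ?_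
        refine (Eq.trans ?_ (congrArg (_ ≫ ·) (godementPresheaf_map_π _ _ _)).symm).trans
          (Category.assoc _ _ _).symm
        refine Eq.trans ?_ (godementLift_π _ _ _).symm
        exact (F.presheaf.map_comp _ _).symm }

instance (F : TopCat.Sheaf M (space X)) : Mono (toGodement X F) := by
  have := toCellular_isEquivalence X M
  refine (toCellular X M).mono_of_mono_map (f := toGodement X F) ?_
  have (s : Simplex X) : Mono (((toCellular X M).map (toGodement X F)).app s) := by
    let A (p : space X) : M := ((toCellular X M).obj F).obj p
    let π : ((toCellular X M).obj (godement A)).obj s ⟶ ((toCellular X M).obj F).obj s :=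
      godementπ (A := A) (U := op (Alexandrov.principalOpen s)) s
        (Alexandrov.self_mem_principalOpen s)
    have h : ((toCellular X M).map (toGodement X F)).app s ≫ π = 𝟙 _ :=
      (godementLift_π (A := A) (E := F.presheaf.obj (op (Alexandrov.principalOpen s)))
        (U := op (Alexandrov.principalOpen s))
        (fun p hp => F.presheaf.map (homOfLE ((Alexandrov.principalOpen_le_iff _).2 hp)).op) s
        (Alexandrov.self_mem_principalOpen s)).trans (F.presheaf.map_id _)
    have hs : IsSplitMono (((toCellular X M).map (toGodement X F)).app s) := ⟨⟨π, h⟩⟩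
    infer_instance
  exact NatTrans.mono_of_mono_app _

/-- If the cohomology of a functor to cochain complexes vanishes on Godement sheaves, then it
vanishes on injective sheaves. -/
lemma exactAt_of_injective {M : Type v} [Category.{u} M] [Abelian M] [IsGrothendieckAbelian.{u} M]
    (C : TopCat.Sheaf M (space X) ⥤ CochainComplex M ℕ) (n : ℕ)
    (h : ∀ A : space X → M, (C.obj (godement A)).ExactAt n)
    (I : TopCat.Sheaf M (space X)) [Injective I] : (C.obj I).ExactAt n := by
  rw [HomologicalComplex.exactAt_iff_isZero_homology]
  let r : godement _ ⟶ I := Injective.factorThru (𝟙 I) (toGodement X I)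
  have hr : toGodement X I ≫ r = 𝟙 I := Injective.comp_factorThru _ _
  let H := C ⋙ HomologicalComplex.homologyFunctor M _ n
  have hz : IsZero (H.obj (godement _)) := (HomologicalComplex.exactAt_iff_isZero_homology _ _).1
    (h fun p : space X => ((toCellular X M).obj I).obj p)
  have h1 : H.map (toGodement X I) ≫ H.map r = 𝟙 _ := by rw [← H.map_comp, hr, H.map_id]
  refine (IsZero.iff_id_eq_zero _).2 (h1.symm.trans ?_)
  rw [IsZero.eq_zero_of_tgt hz (H.map (toGodement X I)), zero_comp]
  rfl

end Embedding

/-! ### Exactness criteria -/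

section Exactness

variable {M : Type v} [Category.{u} M] [Abelian M]

lemma exactAt_succ_of_lift (K : CochainComplex M ℕ) (n : ℕ)
    (h : ∀ (E : M) (z : E ⟶ K.X (n + 1)), z ≫ K.d (n + 1) (n + 1 + 1) = 0 →
      ∃ y : E ⟶ K.X n, y ≫ K.d n (n + 1) = z) : K.ExactAt (n + 1) := by
  rw [HomologicalComplex.exactAt_iff' _ n (n + 1) (n + 1 + 1) (by simp) (by simp),
    ShortComplex.exact_iff_exact_up_to_refinements]
  intro E z hz
  obtain ⟨y, hy⟩ := h E z hz
  exact ⟨E, 𝟙 E, inferInstance, y, (Category.id_comp z).trans hy.symm⟩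

lemma exact_of_lift (S : ShortComplex M)
    (h : ∀ (E : M) (z : E ⟶ S.X₂), z ≫ S.g = 0 → ∃ y : E ⟶ S.X₁, y ≫ S.f = z) : S.Exact := by
  rw [ShortComplex.exact_iff_exact_up_to_refinements]
  intro E z hz
  obtain ⟨y, hy⟩ := h E z hz
  exact ⟨E, 𝟙 E, inferInstance, y, (Category.id_comp z).trans hy.symm⟩

lemma functor_exact_of_pointwise {J : Type*} [Category J] (S : ShortComplex (J ⥤ M))
    (h : ∀ j, (S.map ((evaluation J M).obj j)).Exact) : S.Exact := by
  simp only [ShortComplex.exact_iff_isZero_homology] at h ⊢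
  rw [Functor.isZero_iff]
  exact fun j => IsZero.of_iso (h j) (S.mapHomologyIso ((evaluation J M).obj j)).symm

/-- Products of short exact sequences are short exact if products are exact. -/
lemma shortExact_pi [HasProducts.{u} M] [AB4StarOfSize.{u} M] {ι : Type u} (S : ι → ShortComplex M)
    (h : ∀ i, (S i).ShortExact) :
    (ShortComplex.mk (Limits.Pi.map fun i => (S i).f) (Limits.Pi.map fun i => (S i).g)
      (Limits.Pi.hom_ext _ _ fun i => by simp)).ShortExact := by
  let D : ShortComplex (Discrete ι ⥤ M) :=
    { X₁ := Discrete.functor fun i => (S i).X₁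
      X₂ := Discrete.functor fun i => (S i).X₂
      X₃ := Discrete.functor fun i => (S i).X₃
      f := Discrete.natTrans fun i => (S i.as).f
      g := Discrete.natTrans fun i => (S i.as).g
      zero := by
        ext i
        exact (S i.as).zero }
  have hD : D.ShortExact :=
    { exact := functor_exact_of_pointwise D fun j => (h j.as).exact
      mono_f := by
        have (j : Discrete ι) : Mono (D.f.app j) := (h j.as).mono_f
        exact NatTrans.mono_of_mono_app _
      epi_g := by
        have (j : Discrete ι) : Epi (D.g.app j) := (h j.as).epi_g
        exact NatTrans.epi_of_epi_app _ }
  exact hD.map_of_exact lim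

end Exactness

/-! ### Sections of sheaves -/

section Sections

variable {T : TopCat.{u}} {M : Type v} [Category.{u} M]

/-- Restriction of sections. -/
def res (P : TopCat.Presheaf M T) {U W : Opens T} (h : W ≤ U) : P.obj (op U) ⟶ P.obj (op W) :=
  P.map (homOfLE h).op

@[simp]
lemma res_res (P : TopCat.Presheaf M T) {U W Z : Opens T} (h : W ≤ U) (h' : Z ≤ W) :
    res P h ≫ res P h' = res P (h'.trans h) := (P.map_comp _ _).symm

lemma comp_res_res (P : TopCat.Presheaf M T) {U W Z : Opens T} (h : W ≤ U) (h' : Z ≤ W) {E : M}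
    (f : E ⟶ P.obj (op U)) : (f ≫ res P h) ≫ res P h' = f ≫ res P (h'.trans h) :=
  (Category.assoc _ _ _).trans (congrArg (f ≫ ·) (res_res P h h'))

@[simp]
lemma res_self (P : TopCat.Presheaf M T) {U : Opens T} (h : U ≤ U) :
    res P h = 𝟙 _ := P.map_id _

lemma res_naturality {P Q : TopCat.Presheaf M T} (φ : P ⟶ Q) {U W : Opens T} (h : W ≤ U) :
    res P h ≫ φ.app (op W) = φ.app (op U) ≫ res Q h := φ.naturality _

@[simp]
lemma res_godementπ [HasProducts.{u} M] {A : T → M} {U W : Opens T} (h : W ≤ U) (p : T)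
    (hp : p ∈ W) : res (godementPresheaf A) h ≫ godementπ (U := op W) p hp =
      godementπ (U := op U) p (h hp) :=
  godementPresheaf_map_π _ _ _

/-- Morphisms to the sections of a sheaf over an open cover can be glued uniquely. -/
lemma existsUnique_glue (F : TopCat.Sheaf M T) {ι : Type u} {U : ι → Opens T}
    (hU : ⨆ i, U i = ⊤) (E : M) (z : ∀ i, E ⟶ F.presheaf.obj (op (U i)))
    (hz : ∀ i j, z i ≫ res F.presheaf (inf_le_left : U i ⊓ U j ≤ U i) =
      z j ≫ res F.presheaf inf_le_right) :
    ∃! s : E ⟶ F.presheaf.obj (op ⊤), ∀ i, s ≫ res F.presheaf le_top = z i := by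
  obtain ⟨s, hs, hs'⟩ := existsUnique_glue_hom F U E z hz
  refine ⟨s ≫ res F.presheaf hU.ge, fun i => ?_, fun t ht => ?_⟩
  · rw [Category.assoc, res_res]
    exact hs i
  · have : t ≫ res F.presheaf (le_top : iSup U ≤ ⊤) = s :=
      hs' _ fun i => (Category.assoc _ _ _).trans ((congrArg (t ≫ ·) (res_res _ _ _)).trans (ht i))
    rw [← this, Category.assoc, res_res, res_self, Category.comp_id]

/-- Sections over an open set, as a functor. -/
abbrev sections (M : Type v) [Category.{u} M] (U : Opens T) : TopCat.Sheaf M T ⥤ M :=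
  TopCat.Sheaf.forget M T ⋙ (evaluation (Opens T)ᵒᵖ M).obj (op U)

lemma isZero_sections_bot [Abelian M] (F : TopCat.Sheaf M T) :
    IsZero ((sections M (⊥ : Opens T)).obj F) :=
  (isZero_zero M).of_iso (F.isTerminalOfEmpty.uniqueUpToIso (isZero_zero M).isTerminal)

end Sections

section Star

variable {V : Type u} {X : PreAbstractSimplicialComplex V}
variable {M : Type v} [Category.{u} M] [Abelian M] [IsGrothendieckAbelian.{u} M]

instance (U : Opens (space X)) : (sections (T := space X) M U).Additive where

lemma shortExact_sections_principalOpen (s : Simplex X) (S : ShortComplex (TopCat.Sheaf M (space X)))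
    (hS : S.ShortExact) :
    (S.map (sections (T := space X) M (Alexandrov.principalOpen s))).ShortExact := by
  have := toCellular_isEquivalence X M
  have h1 : PreservesFiniteLimits (toCellular X M ⋙ (evaluation _ M).obj s) :=
    comp_preservesFiniteLimits _ _
  have h2 : PreservesFiniteColimits (toCellular X M ⋙ (evaluation _ M).obj s) :=
    comp_preservesFiniteColimits _ _
  have : (toCellular X M ⋙ (evaluation _ M).obj s).Additive :=
    inferInstanceAs (sections (T := space X) M (Alexandrov.principalOpen s)).Additive
  exact hS.map_of_exact (toCellular X M ⋙ (evaluation _ M).obj s)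

lemma shortExact_sections_bot (S : ShortComplex (TopCat.Sheaf M (space X))) :
    (S.map (sections M (⊥ : Opens (space X)))).ShortExact where
  exact := ShortComplex.exact_of_isZero_X₂ _ (isZero_sections_bot _)
  mono_f := ⟨fun _ _ _ => (isZero_sections_bot S.X₁).eq_of_tgt _ _⟩
  epi_g := ⟨fun _ _ _ => (isZero_sections_bot S.X₃).eq_of_src _ _⟩

end Star

/-! ### The Čech complex -/

section Cech

variable {T : TopCat.{u}} {M : Type v} [Category.{u} M] [Abelian M] [IsGrothendieckAbelian.{u} M]

/-- The intersection of the members of a family of open sets with indices `i`. -/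
abbrev inter (𝒰 : FormalCoproduct.{u} (Opens T)) {n : ℕ} (i : Fin (n + 1) → 𝒰.I) : Opens T :=
  ∏ᶜ (𝒰.obj ∘ i)

lemma inter_le (𝒰 : FormalCoproduct.{u} (Opens T)) {n : ℕ} (i : Fin (n + 1) → 𝒰.I)
    (a : Fin (n + 1)) : inter 𝒰 i ≤ 𝒰.obj (i a) :=
  (Pi.π (𝒰.obj ∘ i) a).le

lemma le_inter (𝒰 : FormalCoproduct.{u} (Opens T)) {n : ℕ} {i : Fin (n + 1) → 𝒰.I}
    {W : Opens T} (h : ∀ a, W ≤ 𝒰.obj (i a)) : W ≤ inter 𝒰 i :=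
  (Pi.lift (f := 𝒰.obj ∘ i) fun a => homOfLE (h a)).le

lemma inter_le_comp (𝒰 : FormalCoproduct.{u} (Opens T)) {m n : ℕ} (i : Fin (n + 1) → 𝒰.I)
    (f : Fin (m + 1) → Fin (n + 1)) : inter 𝒰 i ≤ inter 𝒰 (i ∘ f) :=
  le_inter 𝒰 fun a => inter_le 𝒰 i (f a)

/-- The component of a Čech cochain at a tuple of indices. -/
def cechπ (𝒰 : FormalCoproduct.{u} (Opens T)) (P : TopCat.Presheaf M T) {n : ℕ}
    (i : Fin (n + 1) → 𝒰.I) :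
    (((cechComplex T M).obj (op 𝒰)).obj P).X n ⟶ P.obj (op (inter 𝒰 i)) :=
  Pi.π (fun i : Fin (n + 1) → 𝒰.I => P.obj (op (inter 𝒰 i))) i

lemma cech_hom_ext {𝒰 : FormalCoproduct.{u} (Opens T)} {P : TopCat.Presheaf M T} {n : ℕ} {E : M}
    {f g : E ⟶ (((cechComplex T M).obj (op 𝒰)).obj P).X n}
    (h : ∀ i, f ≫ cechπ 𝒰 P i = g ≫ cechπ 𝒰 P i) : f = g :=
  Pi.hom_ext _ _ h

/-- The Čech cochain with given components. -/
def cechLift {𝒰 : FormalCoproduct.{u} (Opens T)} {P : TopCat.Presheaf M T} {n : ℕ} {E : M}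
    (f : ∀ i : Fin (n + 1) → 𝒰.I, E ⟶ P.obj (op (inter 𝒰 i))) :
    E ⟶ (((cechComplex T M).obj (op 𝒰)).obj P).X n :=
  Pi.lift f

@[simp]
lemma cechLift_π {𝒰 : FormalCoproduct.{u} (Opens T)} {P : TopCat.Presheaf M T} {n : ℕ} {E : M}
    (f : ∀ i : Fin (n + 1) → 𝒰.I, E ⟶ P.obj (op (inter 𝒰 i))) (i : Fin (n + 1) → 𝒰.I) :
    cechLift f ≫ cechπ 𝒰 P i = f i :=
  Pi.lift_π _ _

lemma cechπ_naturality (𝒰 : FormalCoproduct.{u} (Opens T)) {P Q : TopCat.Presheaf M T} (φ : P ⟶ Q)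
    {n : ℕ} (i : Fin (n + 1) → 𝒰.I) :
    (((cechComplex T M).obj (op 𝒰)).map φ).f n ≫ cechπ 𝒰 Q i =
      cechπ 𝒰 P i ≫ φ.app (op (inter 𝒰 i)) :=
  Limits.Pi.map_π (fun i : Fin (n + 1) → 𝒰.I => φ.app (op (inter 𝒰 i))) i

lemma cech_d_π (𝒰 : FormalCoproduct.{u} (Opens T)) (P : TopCat.Presheaf M T) {n : ℕ}
    (i : Fin (n + 2) → 𝒰.I) :
    (((cechComplex T M).obj (op 𝒰)).obj P).d n (n + 1) ≫ cechπ 𝒰 P i =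
      ∑ j : Fin (n + 2), (-1 : ℤ) ^ (j : ℕ) • (cechπ 𝒰 P (i ∘ j.succAbove) ≫
        res P (inter_le_comp 𝒰 i j.succAbove)) := by
  refine (congrArg (· ≫ cechπ 𝒰 P i) (CochainComplex.of_d _ _ _)).trans ?_
  refine (Preadditive.sum_comp _ _ _).trans (Finset.sum_congr rfl fun j _ => ?_)
  exact (Preadditive.zsmul_comp _ _ _).trans (congrArg _ (Pi.lift_π _ _))

section Components

variable {𝒰 : FormalCoproduct.{u} (Opens T)} {P : TopCat.Presheaf M T} {n : ℕ} {E : M}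

/-- The restriction of a component of a Čech cochain. -/
def cechRes (z : E ⟶ (((cechComplex T M).obj (op 𝒰)).obj P).X n) (i : Fin (n + 1) → 𝒰.I)
    {W : Opens T} (h : W ≤ inter 𝒰 i) : E ⟶ P.obj (op W) :=
  (z ≫ cechπ 𝒰 P i) ≫ res P h

lemma cechRes_congr (z : E ⟶ (((cechComplex T M).obj (op 𝒰)).obj P).X n)
    {i i' : Fin (n + 1) → 𝒰.I} (hi : i = i') {W : Opens T} (h : W ≤ inter 𝒰 i)
    (h' : W ≤ inter 𝒰 i') : cechRes z i h = cechRes z i' h' := by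
  subst hi
  rfl

@[simp]
lemma cechRes_res (z : E ⟶ (((cechComplex T M).obj (op 𝒰)).obj P).X n) (i : Fin (n + 1) → 𝒰.I)
    {W W' : Opens T} (h : W ≤ inter 𝒰 i) (h' : W' ≤ W) :
    cechRes z i h ≫ res P h' = cechRes z i (h'.trans h) := by
  rw [cechRes, Category.assoc, res_res, cechRes]

lemma cechRes_self (z : E ⟶ (((cechComplex T M).obj (op 𝒰)).obj P).X n) (i : Fin (n + 1) → 𝒰.I) :
    cechRes z i le_rfl = z ≫ cechπ 𝒰 P i := by
  rw [cechRes, res_self, Category.comp_id]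

lemma cechRes_comp_d (z : E ⟶ (((cechComplex T M).obj (op 𝒰)).obj P).X n)
    (i : Fin (n + 2) → 𝒰.I) {W : Opens T} (h : W ≤ inter 𝒰 i) :
    cechRes (z ≫ (((cechComplex T M).obj (op 𝒰)).obj P).d n (n + 1)) i h =
      ∑ j : Fin (n + 2), (-1 : ℤ) ^ (j : ℕ) •
        cechRes z (i ∘ j.succAbove) (h.trans (inter_le_comp 𝒰 i j.succAbove)) := by
  rw [cechRes, Category.assoc, Category.assoc, ← Category.assoc _ _ (res P h), cech_d_π,
    Preadditive.sum_comp, Preadditive.comp_sum]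
  refine Finset.sum_congr rfl fun j _ => ?_
  rw [Preadditive.zsmul_comp, Preadditive.comp_zsmul, Category.assoc, res_res, cechRes,
    Category.assoc]

end Components

/-- The augmentation of the Čech complex. -/
def toCech (𝒰 : FormalCoproduct.{u} (Opens T)) (P : TopCat.Presheaf M T) :
    P.obj (op ⊤) ⟶ (((cechComplex T M).obj (op 𝒰)).obj P).X 0 :=
  cechLift fun _ => res P le_top

lemma cechRes_comp_toCech {𝒰 : FormalCoproduct.{u} (Opens T)} {P : TopCat.Presheaf M T} {E : M}
    (s : E ⟶ P.obj (op ⊤)) (i : Fin 1 → 𝒰.I) {W : Opens T} (h : W ≤ inter 𝒰 i) :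
    cechRes (s ≫ toCech 𝒰 P) i h = s ≫ res P le_top := by
  rw [cechRes, Category.assoc s, toCech, cechLift_π, Category.assoc, res_res]

lemma toCech_d (𝒰 : FormalCoproduct.{u} (Opens T)) (P : TopCat.Presheaf M T) :
    toCech 𝒰 P ≫ (((cechComplex T M).obj (op 𝒰)).obj P).d 0 1 = 0 := by
  refine cech_hom_ext fun i => ?_
  rw [← Category.id_comp (toCech 𝒰 P), ← cechRes_self, cechRes_comp_d, zero_comp]
  simp only [cechRes_comp_toCech, Fin.sum_univ_succ]
  simp

lemma exact_toCech (𝒰 : Cover T) (F : TopCat.Sheaf M T) :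
    (ShortComplex.mk _ _ (toCech_d 𝒰.obj F.presheaf)).Exact ∧ Mono (toCech 𝒰.obj F.presheaf) := by
  have hi (i : Fin 1 → 𝒰.obj.I) : (fun _ => i 0) = i :=
    funext fun a => congrArg i (Subsingleton.elim (α := Fin 1) _ _)
  have key (i : Fin 1 → 𝒰.obj.I) : 𝒰.obj.obj (i 0) ≤ inter 𝒰.obj (n := 0) i :=
    le_inter 𝒰.obj fun a => (congrArg 𝒰.obj.obj (congrFun (hi i) a)).le
  constructor
  · refine exact_of_lift _ fun E z hz => ?_
    obtain ⟨s, hs, -⟩ := existsUnique_glue F 𝒰.property E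
      (fun x => cechRes (n := 0) (P := F.presheaf) z (fun _ => x) (key fun _ => x))
      fun x y => by
        have hle : 𝒰.obj.obj x ⊓ 𝒰.obj.obj y ≤ inter 𝒰.obj (n := 1) ![y, x] :=
          le_inter 𝒰.obj fun a => by
            fin_cases a
            exacts [inf_le_right, inf_le_left]
        have h := (cechRes_comp_d (P := F.presheaf) (n := 0) z ![y, x] hle).symm.trans
          ((congrArg (fun w => cechRes (n := 1) w ![y, x] hle) hz).trans
            ((congrArg (· ≫ _) zero_comp).trans zero_comp))
        rw [Fin.sum_univ_two] at h
        have h0 : (![y, x] ∘ (0 : Fin 2).succAbove : Fin 1 → 𝒰.obj.I) = fun _ => x := by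
          ext a; fin_cases a; rfl
        have h1 : (![y, x] ∘ (1 : Fin 2).succAbove : Fin 1 → 𝒰.obj.I) = fun _ => y := by
          ext a; fin_cases a; rfl
        rw [cechRes_congr (P := F.presheaf) (n := 0) z h0 _
            (inf_le_left.trans (key fun _ => x)),
          cechRes_congr (P := F.presheaf) (n := 0) z h1 _
            (inf_le_right.trans (key fun _ => y))] at h
        refine (cechRes_res (P := F.presheaf) (n := 0) z _ _ _).trans (Eq.trans ?_
          (cechRes_res (P := F.presheaf) (n := 0) z _ _ _).symm)
        simpa [← sub_eq_add_neg, sub_eq_zero] using h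
    refine ⟨s, cech_hom_ext (n := 0) fun i => ?_⟩
    refine (cechRes_self _ _).symm.trans ((cechRes_comp_toCech s i le_rfl).trans ?_)
    have h := congrArg (· ≫ res F.presheaf (inter_le 𝒰.obj (n := 0) i 0)) (hs (i 0))
    refine ((congrArg (s ≫ ·) (res_res _ _ _)).symm.trans (Category.assoc _ _ _).symm).trans
      (h.trans ((cechRes_res (P := F.presheaf) (n := 0) z _ _ _).trans
        ((cechRes_congr (P := F.presheaf) (n := 0) z (hi i) _ le_rfl).trans (cechRes_self _ _))))
  · refine ⟨fun {E} s t h => ?_⟩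
    have hst (x : 𝒰.obj.I) : t ≫ res F.presheaf (le_top : 𝒰.obj.obj x ≤ ⊤) =
        s ≫ res F.presheaf le_top := by
      rw [← cechRes_comp_toCech t (fun _ => x) (key fun _ => x), ← h, cechRes_comp_toCech]
    obtain ⟨r, -, hr⟩ := existsUnique_glue F 𝒰.property E
      (fun x => s ≫ res F.presheaf (le_top : 𝒰.obj.obj x ≤ ⊤)) fun x y => by
        rw [Category.assoc, Category.assoc, res_res, res_res]
    exact (hr s fun _ => rfl).trans (hr t hst).symm

lemma mem_inter {𝒰 : FormalCoproduct.{u} (Opens T)} {n : ℕ} {i : Fin (n + 1) → 𝒰.I} {p : T} :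
    p ∈ inter 𝒰 i ↔ ∀ a, p ∈ 𝒰.obj (i a) := by
  refine ⟨fun h a => inter_le 𝒰 i a h, fun h => ?_⟩
  have hle : Finset.univ.inf (fun a => 𝒰.obj (i a)) ≤ inter 𝒰 i :=
    le_inter 𝒰 fun a => Finset.inf_le (Finset.mem_univ a)
  refine hle ?_
  rw [← SetLike.mem_coe, Opens.coe_finset_inf]
  simpa using h

section Godement

variable {𝒰 : FormalCoproduct.{u} (Opens T)} {A : T → M} {n : ℕ} {E : M}

/-- The component at a tuple of indices and a point of a Čech cochain of a Godement sheaf. -/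
def cechAt (z : E ⟶ (((cechComplex T M).obj (op 𝒰)).obj (godementPresheaf A)).X n)
    (i : Fin (n + 1) → 𝒰.I) (p : T) (hp : ∀ a, p ∈ 𝒰.obj (i a)) : E ⟶ A p :=
  (z ≫ cechπ 𝒰 (godementPresheaf A) i) ≫ godementπ (U := op (inter 𝒰 i)) p (mem_inter.2 hp)

lemma cechAt_congr (z : E ⟶ (((cechComplex T M).obj (op 𝒰)).obj (godementPresheaf A)).X n)
    {i i' : Fin (n + 1) → 𝒰.I} (hi : i = i') (p : T) (hp : ∀ a, p ∈ 𝒰.obj (i a))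
    (hp' : ∀ a, p ∈ 𝒰.obj (i' a)) : cechAt z i p hp = cechAt z i' p hp' := by
  subst hi
  rfl

lemma cechAt_hom_ext {y z : E ⟶ (((cechComplex T M).obj (op 𝒰)).obj (godementPresheaf A)).X n}
    (h : ∀ i p hp, cechAt y i p hp = cechAt z i p hp) : y = z :=
  cech_hom_ext fun i => godement_hom_ext fun p hp => h i p (mem_inter.1 hp)

lemma cechAt_comp_d (z : E ⟶ (((cechComplex T M).obj (op 𝒰)).obj (godementPresheaf A)).X n)
    (i : Fin (n + 2) → 𝒰.I) (p : T) (hp : ∀ a, p ∈ 𝒰.obj (i a)) :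
    cechAt (z ≫ (((cechComplex T M).obj (op 𝒰)).obj (godementPresheaf A)).d n (n + 1)) i p hp =
      ∑ j : Fin (n + 2), (-1 : ℤ) ^ (j : ℕ) •
        cechAt z (i ∘ j.succAbove) p (fun a => hp (j.succAbove a)) := by
  rw [cechAt, ← cechRes_self, cechRes_comp_d, Preadditive.sum_comp]
  refine Finset.sum_congr rfl fun j _ => ?_
  rw [Preadditive.zsmul_comp, cechRes, Category.assoc, res_godementπ]
  rfl

lemma exactAt_cech_godement (h𝒰 : ⨆ i, 𝒰.obj i = ⊤) (A : T → M) (n : ℕ) :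
    (((cechComplex T M).obj (op 𝒰)).obj (godementPresheaf A)).ExactAt (n + 1) := by
  have hv (p : T) : ∃ i, p ∈ 𝒰.obj i := by
    rw [← Opens.mem_iSup, h𝒰]
    trivial
  choose v hv using hv
  have hcons {n : ℕ} (i : Fin (n + 1) → 𝒰.I) (p : T) (hp : ∀ a, p ∈ 𝒰.obj (i a)) :
      ∀ a, p ∈ 𝒰.obj ((Fin.cons (v p) i : Fin (n + 2) → 𝒰.I) a) :=
    Fin.cases (hv p) hp
  refine exactAt_succ_of_lift _ _ fun E z hz => ?_
  let y : E ⟶ (((cechComplex T M).obj (op 𝒰)).obj (godementPresheaf A)).X n :=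
    cechLift fun i => godementLift fun p hp =>
      cechAt z (Fin.cons (v p) i) p (hcons i p (mem_inter.1 hp))
  have hy (i : Fin (n + 1) → 𝒰.I) (p : T) (hp : ∀ a, p ∈ 𝒰.obj (i a)) :
      cechAt y i p hp = cechAt z (Fin.cons (v p) i) p (hcons i p hp) := by
    rw [cechAt, cechLift_π, godementLift_π]
  refine ⟨y, cechAt_hom_ext fun i p hp => ?_⟩
  rw [cechAt_comp_d]
  have h : cechAt (z ≫ (((cechComplex T M).obj (op 𝒰)).obj (godementPresheaf A)).d (n + 1)
      (n + 1 + 1)) (Fin.cons (v p) i) p (hcons i p hp) = 0 := by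
    rw [hz, cechAt, zero_comp, zero_comp]
  rw [cechAt_comp_d, Fin.sum_univ_succ] at h
  have h0 : (Fin.cons (v p) i : Fin (n + 3) → 𝒰.I) ∘ (0 : Fin (n + 3)).succAbove = i := by
    ext a
    simp
  have hs (j : Fin (n + 2)) : (Fin.cons (v p) i : Fin (n + 3) → 𝒰.I) ∘ j.succ.succAbove =
      Fin.cons (v p) (i ∘ j.succAbove) := by
    ext a
    cases a using Fin.cases <;> simp
  rw [cechAt_congr z h0 p _ hp] at h
  simp only [Fin.val_zero, pow_zero, one_smul, Fin.val_succ, pow_succ, mul_neg, mul_one, neg_smul,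
    Finset.sum_neg_distrib, ← sub_eq_add_neg, sub_eq_zero] at h
  rw [h]
  refine Finset.sum_congr rfl fun j _ => ?_
  rw [hy, cechAt_congr z (hs j)]

end Godement

/-- The Čech complex of a sheaf, as a functor. -/
abbrev sheafCech (M : Type v) [Category.{u} M] [Abelian M] [IsGrothendieckAbelian.{u} M]
    (𝒰 : FormalCoproduct.{u} (Opens T)) : TopCat.Sheaf M T ⥤ CochainComplex M ℕ :=
  TopCat.Sheaf.forget M T ⋙ (cechComplex T M).obj (op 𝒰)

end Cech

section Star

variable {V : Type u} {X : PreAbstractSimplicialComplex V}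
variable {M : Type v} [Category.{u} M] [Abelian M] [IsGrothendieckAbelian.{u} M]

instance (𝒰 : FormalCoproduct.{u} (Opens (space X))) :
    (sheafCech M 𝒰).PreservesZeroMorphisms where
  map_zero F G := by
    refine HomologicalComplex.hom_ext _ _ fun n => cech_hom_ext fun i => ?_
    refine (cechπ_naturality 𝒰 _ i).trans ?_
    exact comp_zero.trans zero_comp.symm

lemma inter_starCover {n : ℕ} (i : Fin (n + 1) → Vertex X) :
    (∃ s : Simplex X, inter (starCover X).obj i = Alexandrov.principalOpen s) ∨
      inter (starCover X).obj i = ⊥ := by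
  classical
  rw [or_iff_not_imp_right]
  intro h
  obtain ⟨p, hp⟩ := Opens.ne_bot_iff_nonempty _ |>.1 h
  have hi (q : Simplex X) : q ∈ inter (starCover X).obj i ↔
      Finset.univ.image (fun a => (i a).1) ⊆ q.verts := by
    refine mem_inter.trans (Iff.trans ?_ Finset.image_subset_iff.symm)
    exact forall_congr' fun a => Finset.singleton_subset_iff.trans (by simp)
  refine ⟨⟨Finset.univ.image fun a => (i a).1, (X.isRelLowerSet_faces p.verts_mem).2
    ((hi p).1 hp) (Finset.univ_nonempty.image _)⟩, Opens.ext (Set.ext fun q => hi q)⟩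

lemma shortExact_sheafCech_starCover [AB4Star M] (S : ShortComplex (TopCat.Sheaf M (space X)))
    (hS : S.ShortExact) : (S.map (sheafCech M (starCover X).obj)).ShortExact := by
  refine HomologicalComplex.shortExact_of_degreewise_shortExact _ fun n => ?_
  refine shortExact_pi (fun i : Fin (n + 1) → Vertex X =>
    S.map (sections M (inter (starCover X).obj i))) fun i => ?_
  obtain ⟨s, hs⟩ | h := inter_starCover i
  · rw [hs]
    exact shortExact_sections_principalOpen s S hS
  · rw [h]
    exact shortExact_sections_bot S

lemma nonempty_sheafCohomology_iso_cech [AB4Star M] (k : ℕ) :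
    Nonempty (sheafCohomology X M k ≅
      (cechDiagram (space X) M k).obj (op (starCover X))) := by
  obtain ⟨E⟩ := nonempty_injectiveEmbedding (TopCat.Sheaf M (space X))
  let a : globalSections X M ⟶ sheafCech M (starCover X).obj ⋙ HomologicalComplex.eval M _ 0 :=
    { app F := toCech (starCover X).obj F.presheaf
      naturality F G φ := cech_hom_ext (n := 0) fun i => by
        refine (Category.assoc _ _ _).trans ?_
        refine (congrArg (_ ≫ ·) (cechLift_π _ i)).trans ?_
        refine Eq.trans ?_ (Category.assoc _ _ _).symm
        refine Eq.trans ?_ (congrArg (_ ≫ ·) (cechπ_naturality _ φ.hom i)).symm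
        refine Eq.trans ?_ (Category.assoc _ _ _)
        refine Eq.trans ?_ (congrArg (· ≫ _) (cechLift_π _ i)).symm
        exact (res_naturality φ.hom le_top).symm }
  exact nonempty_rightDerived_iso E (globalSections X M) (sheafCech M (starCover X).obj)
    shortExact_sheafCech_starCover
    (fun I _ n => exactAt_of_injective X (sheafCech M (starCover X).obj) (n + 1)
      (fun A => exactAt_cech_godement (starCover X).property A n) I)
    a (fun F => toCech_d _ _) (fun F => exact_toCech (starCover X) F) k

end Star

/-! ### The cellular complex -/

section Combinatorics

variable {V : Type u} [LinearOrder V]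

lemma card_filter_lt_insert {v x : V} {t : Finset V} (hv : v ∉ t) (h : v < x) :
    ((insert v t).filter (· < x)).card = (t.filter (· < x)).card + 1 := by
  rw [Finset.filter_insert, if_pos h, Finset.card_insert_of_notMem]
  exact fun h' => hv (Finset.mem_of_mem_filter _ h')

lemma card_filter_lt_of_forall_le {v : V} {t : Finset V} (h : ∀ x ∈ t, v ≤ x) :
    (t.filter (· < v)).card = 0 :=
  Finset.card_eq_zero.2 (Finset.filter_eq_empty_iff.2 fun x hx => (h x hx).not_gt)

/-- The cone construction with a minimal vertex as its apex is a contracting homotopy. -/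
lemma sum_cone {G : Type*} [AddCommGroup G] {v : V} {p : Finset V} (hvp : v ∈ p)
    (hv : ∀ x ∈ p, v ≤ x) (n : ℕ) (Z : Finset V → G)
    (hZ : ∀ r ⊆ p, r.card = n + 1 →
      ∑ x ∈ r, (-1 : ℤ) ^ (r.filter (· < x)).card • Z (r.erase x) = 0)
    {t : Finset V} (htp : t ⊆ p) (ht : t.card = n) :
    ∑ x ∈ t, (-1 : ℤ) ^ (t.filter (· < x)).card •
      (if v ∈ t.erase x then 0 else Z (insert v (t.erase x))) = Z t := by
  by_cases h : v ∈ t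
  · rw [Finset.sum_eq_single_of_mem v h]
    · rw [if_neg (Finset.notMem_erase v t), Finset.insert_erase h,
        card_filter_lt_of_forall_le fun x hx => hv x (htp hx), pow_zero, one_smul]
    · intro x _ hx
      rw [if_pos (Finset.mem_erase.2 ⟨hx.symm, h⟩), smul_zero]
  · have h1 := hZ (insert v t) (Finset.insert_subset hvp htp)
      (by rw [Finset.card_insert_of_notMem h, ht])
    rw [Finset.sum_insert h, Finset.erase_insert h, card_filter_lt_of_forall_le fun x hx =>
      hv x (Finset.insert_subset hvp htp hx), pow_zero, one_smul] at h1
    rw [eq_neg_of_add_eq_zero_left h1, ← Finset.sum_neg_distrib]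
    refine Finset.sum_congr rfl fun x hx => ?_
    have hvx : v ≠ x := fun e => h (e ▸ hx)
    rw [if_neg fun h' => h (Finset.mem_of_mem_erase h'), Finset.erase_insert_of_ne hvx,
      card_filter_lt_insert h (lt_of_le_of_ne (hv x (htp hx)) hvx), pow_succ, mul_neg, mul_one,
      neg_smul, neg_neg]

end Combinatorics

section Faces

variable {V : Type u} {X : PreAbstractSimplicialComplex V}

lemma exists_simplexOfDim {k : ℕ} {p : Simplex X} {r : Finset V} (h : r ⊆ p.verts) (hr : r.card = k + 1) :
    ∃ s : SimplexOfDim X k, s.1.verts = r :=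
  ⟨⟨⟨r, (X.isRelLowerSet_faces p.verts_mem).2 h (Finset.card_pos.1 (by omega))⟩, hr⟩, rfl⟩

/-- A vertex, viewed as a `0`-simplex. -/
def Vertex.simplexOfDim (x : Vertex X) : SimplexOfDim X 0 := ⟨x.simplex, Finset.card_singleton _⟩

lemma exists_vertex {p : Simplex X} {v : V} (hv : v ∈ p.verts) : ∃ x : Vertex X, x.1 = v :=
  ⟨⟨v, (X.isRelLowerSet_faces p.verts_mem).2 (Finset.singleton_subset_iff.2 hv)
    (Finset.singleton_nonempty v)⟩, rfl⟩

variable [LinearOrder V]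

lemma exists_face {k : ℕ} (t : SimplexOfDim X (k + 1)) {x : V} (hx : x ∈ t.1.verts) :
    ∃ s : SimplexOfDim X k, s.1.verts = t.1.verts.erase x ∧ s.1 ≤ t.1 := by
  have hc : (t.1.verts.erase x).card = k + 1 := by
    rw [Finset.card_erase_of_mem hx, t.2]
    rfl
  exact ⟨⟨⟨t.1.verts.erase x, (X.isRelLowerSet_faces t.1.verts_mem).2
    (Finset.erase_subset _ _) (Finset.card_pos.1 (by omega))⟩, hc⟩, rfl, Finset.erase_subset _ _⟩

lemma exists_edge (t : SimplexOfDim X 1) : ∃ v w, v < w ∧ t.1.verts = {v, w} := by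
  obtain ⟨v, w, hvw, h⟩ := Finset.card_eq_two.1 t.2
  rcases lt_or_gt_of_ne hvw with h' | h'
  · exact ⟨v, w, h', h⟩
  · exact ⟨w, v, h', h.trans (Finset.pair_comm v w)⟩

end Faces

section Cellular

variable {V : Type u} [LinearOrder V] {X : PreAbstractSimplicialComplex V}
variable {M : Type v} [Category.{u} M] [Abelian M] [Finite (Simplex X)]

attribute [local instance] Abelian.hasFiniteBiproducts

/-- The component of a cellular cochain at a simplex. -/
def cellπ (F : Simplex X ⥤ M) {k : ℕ} (s : SimplexOfDim X k) :
    (cellularComplex F).X k ⟶ F.obj s.1 :=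
  biproduct.π (fun s : SimplexOfDim X k => F.obj s.1) s

/-- The cellular cochain with given components. -/
def cellLift {F : Simplex X ⥤ M} {k : ℕ} {E : M} (f : ∀ s : SimplexOfDim X k, E ⟶ F.obj s.1) :
    E ⟶ (cellularComplex F).X k :=
  biproduct.lift f

@[simp]
lemma cellLift_π {F : Simplex X ⥤ M} {k : ℕ} {E : M} (f : ∀ s : SimplexOfDim X k, E ⟶ F.obj s.1)
    (s : SimplexOfDim X k) : cellLift f ≫ cellπ F s = f s :=
  biproduct.lift_π _ _

lemma cell_hom_ext {F : Simplex X ⥤ M} {k : ℕ} {E : M} {f g : E ⟶ (cellularComplex F).X k}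
    (h : ∀ s, f ≫ cellπ F s = g ≫ cellπ F s) : f = g :=
  biproduct.hom_ext _ _ h

lemma cellπ_naturality {F G : Simplex X ⥤ M} (φ : F ⟶ G) {k : ℕ} (s : SimplexOfDim X k) :
    ((cellularComplexFunctor X M).map φ).f k ≫ cellπ G s = cellπ F s ≫ φ.app s.1 :=
  biproduct.map_π (fun s : SimplexOfDim X k => φ.app s.1) s

lemma cell_d_π (F : Simplex X ⥤ M) {k : ℕ} [Fintype (SimplexOfDim X k)]
    (t : SimplexOfDim X (k + 1)) :
    (cellularComplex F).d k (k + 1) ≫ cellπ F t =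
      ∑ s : SimplexOfDim X k, cellπ F s ≫ coboundaryEntry F s.1 t.1 := by
  refine (congrArg (· ≫ cellπ F t) (CochainComplex.of_d _ _ _)).trans ?_
  refine (biproduct.lift_π _ _).trans ?_
  have h1 : biproduct.lift (biproduct.π fun s : SimplexOfDim X k => F.obj s.1) = 𝟙 _ :=
    biproduct.hom_ext _ _ fun j => by simp
  rw [← Category.id_comp (biproduct.desc _), ← h1]
  exact lift_comp_desc _ _

open Classical in
/-- The value at the simplex `p` of the component at `r` of a cellular cochain, which is zero
unless `r` is a face of `p`. -/
def cellAt {F : Simplex X ⥤ M} {k : ℕ} {E : M} (z : E ⟶ (cellularComplex F).X k) (r : Finset V)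
    (p : Simplex X) : E ⟶ F.obj p :=
  if h : ∃ s : SimplexOfDim X k, s.1.verts = r ∧ s.1 ≤ p then
    (z ≫ cellπ F h.choose) ≫ F.map (homOfLE h.choose_spec.2) else 0

lemma cellAt_eq {F : Simplex X ⥤ M} {k : ℕ} {E : M} (z : E ⟶ (cellularComplex F).X k)
    (s : SimplexOfDim X k) {r : Finset V} (hr : s.1.verts = r) {p : Simplex X} (h : s.1 ≤ p) :
    cellAt z r p = (z ≫ cellπ F s) ≫ F.map (homOfLE h) := by
  have h' : ∃ s : SimplexOfDim X k, s.1.verts = r ∧ s.1 ≤ p := ⟨s, hr, h⟩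
  have key (s' : SimplexOfDim X k) (e : s' = s) (h' : s'.1 ≤ p) :
      (z ≫ cellπ F s') ≫ F.map (homOfLE h') = (z ≫ cellπ F s) ≫ F.map (homOfLE h) := by
    subst e
    rfl
  rw [cellAt, dif_pos h']
  exact key _ (Subtype.ext (Simplex.verts_injective (h'.choose_spec.1.trans hr.symm))) _

lemma cellAt_self {F : Simplex X ⥤ M} {k : ℕ} {E : M} (z : E ⟶ (cellularComplex F).X k)
    (s : SimplexOfDim X k) : cellAt z s.1.verts s.1 = z ≫ cellπ F s :=
  (cellAt_eq z s rfl le_rfl).trans ((congrArg ((z ≫ cellπ F s) ≫ ·) (F.map_id _)).trans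
    (Category.comp_id _))

lemma cellAt_comp_d {F : Simplex X ⥤ M} {k : ℕ} {E : M} (z : E ⟶ (cellularComplex F).X k)
    (t : SimplexOfDim X (k + 1)) {p : Simplex X} (h : t.1 ≤ p) :
    cellAt (z ≫ (cellularComplex F).d k (k + 1)) t.1.verts p =
      ∑ x ∈ t.1.verts, (-1 : ℤ) ^ (t.1.verts.filter (· < x)).card •
        cellAt z (t.1.verts.erase x) p := by
  classical
  have := Fintype.ofFinite (SimplexOfDim X k)
  rw [cellAt_eq _ t rfl h, Category.assoc, Category.assoc,
    ← Category.assoc _ _ (F.map (homOfLE h)), cell_d_π, Preadditive.sum_comp,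
    Preadditive.comp_sum]
  have h1 (s : SimplexOfDim X k) : z ≫ (cellπ F s ≫ coboundaryEntry F s.1 t.1) ≫
      F.map (homOfLE h) = ∑ x ∈ t.1.verts, (if t.1.verts.erase x = s.1.verts then
        (-1 : ℤ) ^ (t.1.verts.filter (· < x)).card else 0) • cellAt z s.1.verts p := by
    rw [← Finset.sum_smul]
    change _ = incidence _ _ • _
    unfold coboundaryEntry
    by_cases hs : s.1 ≤ t.1
    · rw [dif_pos hs, cellAt_eq z s rfl (hs.trans h), Preadditive.comp_zsmul,
        Preadditive.zsmul_comp, Preadditive.comp_zsmul, Category.assoc, ← F.map_comp,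
        Category.assoc]
      rfl
    · rw [dif_neg hs, incidence_eq_zero hs, zero_smul, comp_zero, zero_comp, comp_zero]
  rw [Finset.sum_congr rfl fun s _ => h1 s, Finset.sum_comm]
  refine Finset.sum_congr rfl fun x hx => ?_
  obtain ⟨s, hs, hst⟩ := exists_face t hx
  rw [Finset.sum_eq_single s]
  · rw [if_pos hs.symm, hs]
  · intro s' _ hs'
    rw [if_neg, zero_smul]
    exact fun e => hs' (Subtype.ext (Simplex.verts_injective (e.symm.trans hs.symm)))
  · exact fun h => absurd (Finset.mem_univ s) h

lemma cellAt_comp_d_edge {F : Simplex X ⥤ M} {E : M} (z : E ⟶ (cellularComplex F).X 0)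
    (t : SimplexOfDim X 1) {p : Simplex X} (h : t.1 ≤ p) {v w : V} (hvw : v < w)
    (ht : t.1.verts = {v, w}) :
    cellAt (z ≫ (cellularComplex F).d 0 1) t.1.verts p = cellAt z {w} p - cellAt z {v} p := by
  have h1 : ({v, w} : Finset V).erase v = {w} := by
    rw [Finset.erase_insert (by simpa using hvw.ne)]
  have h2 : ({v, w} : Finset V).erase w = {v} := by
    rw [Finset.pair_comm, Finset.erase_insert (by simpa using hvw.ne')]
  rw [cellAt_comp_d z t h, ht, Finset.sum_pair hvw.ne, h1, h2]
  simp [Finset.filter_insert, Finset.filter_singleton, hvw, hvw.not_gt, sub_eq_add_neg]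

section Godement

variable [IsGrothendieckAbelian.{u} M] {A : space X → M} {k : ℕ} {E : M}

/-- The component at a face of a simplex and at this simplex of a cellular cochain of a Godement
sheaf. -/
def cellGodement (z : E ⟶ (cellularComplex ((toCellular X M).obj (godement A))).X k)
    (r : Finset V) (p : Simplex X) : E ⟶ A p :=
  cellAt z r p ≫ godementπ (A := A) (U := op (Alexandrov.principalOpen p)) p
    (Alexandrov.self_mem_principalOpen p)

lemma cellGodement_eq (z : E ⟶ (cellularComplex ((toCellular X M).obj (godement A))).X k)
    (s : SimplexOfDim X k) {r : Finset V} (hr : s.1.verts = r) {p : Simplex X} (h : s.1 ≤ p) :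
    cellGodement z r p = (z ≫ cellπ _ s) ≫
      godementπ (A := A) (U := op (Alexandrov.principalOpen s.1)) p h := by
  refine (congrArg (· ≫ _) (cellAt_eq z s hr h)).trans ((Category.assoc _ _ _).trans ?_)
  exact congrArg ((z ≫ cellπ _ s) ≫ ·) (godementPresheaf_map_π _ _ _)

lemma cellGodement_hom_ext
    {y z : E ⟶ (cellularComplex ((toCellular X M).obj (godement A))).X k}
    (h : ∀ (s : SimplexOfDim X k) (p : Simplex X), s.1 ≤ p →
      cellGodement y s.1.verts p = cellGodement z s.1.verts p) : y = z := by
  refine cell_hom_ext fun s => godement_hom_ext (A := A)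
    (U := op (Alexandrov.principalOpen s.1)) fun p hp => ?_
  exact (cellGodement_eq y s rfl hp).symm.trans ((h s p hp).trans (cellGodement_eq z s rfl hp))

lemma cellGodement_comp_d (z : E ⟶ (cellularComplex ((toCellular X M).obj (godement A))).X k)
    (t : SimplexOfDim X (k + 1)) {p : Simplex X} (h : t.1 ≤ p) :
    cellGodement (z ≫ (cellularComplex _).d k (k + 1)) t.1.verts p =
      ∑ x ∈ t.1.verts, (-1 : ℤ) ^ (t.1.verts.filter (· < x)).card •
        cellGodement z (t.1.verts.erase x) p := by
  refine (congrArg (· ≫ _) (cellAt_comp_d z t h)).trans ((Preadditive.sum_comp _ _ _).trans ?_)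
  exact Finset.sum_congr rfl fun x _ => Preadditive.zsmul_comp _ _ _

variable (A) in
lemma exactAt_cellularComplex_godement (n : ℕ) :
    (cellularComplex ((toCellular X M).obj (godement A))).ExactAt (n + 1) := by
  refine exactAt_succ_of_lift _ _ fun E z hz => ?_
  let v (p : Simplex X) : V := p.verts.min' p.verts_nonempty
  let y : E ⟶ (cellularComplex ((toCellular X M).obj (godement A))).X n :=
    cellLift fun s => godementLift (A := A) (U := op (Alexandrov.principalOpen s.1)) fun p _ =>
      if v p ∈ s.1.verts then 0 else cellGodement z (insert (v p) s.1.verts) p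
  have hy (s : SimplexOfDim X n) (p : Simplex X) (hs : s.1 ≤ p) :
      cellGodement y s.1.verts p =
        if v p ∈ s.1.verts then 0 else cellGodement z (insert (v p) s.1.verts) p := by
    rw [cellGodement_eq y s rfl hs]
    exact (congrArg (· ≫ _) (cellLift_π _ s)).trans (godementLift_π (A := A)
      (U := op (Alexandrov.principalOpen s.1)) _ p hs)
  refine ⟨y, cellGodement_hom_ext fun t p htp => ?_⟩
  rw [cellGodement_comp_d y t htp]
  refine Eq.trans (Finset.sum_congr rfl fun x hx => ?_)
    (sum_cone (p.verts.min'_mem p.verts_nonempty) (fun x hx => p.verts.min'_le x hx) (n + 2)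
      (fun r => cellGodement z r p) (fun r hr hc => ?_) htp t.2)
  · obtain ⟨s, hs, hst⟩ := exists_face t hx
    rw [← hs, hy s p (hst.trans htp)]
  · obtain ⟨s, rfl⟩ := exists_simplexOfDim hr hc
    refine (cellGodement_comp_d z s hr).symm.trans ?_
    rw [hz, cellGodement_eq _ s rfl hr]
    exact (congrArg (· ≫ _) zero_comp).trans zero_comp

end Godement

section Augmentation

/-- The augmentation of the cellular complex of a sheaf. -/
def toCell (F : TopCat.Sheaf M (space X)) :
    F.presheaf.obj (op ⊤) ⟶ (cellularComplex ((toCellular X M).obj F)).X 0 :=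
  cellLift fun _ => res F.presheaf le_top

lemma cellAt_comp_toCell {F : TopCat.Sheaf M (space X)} {E : M} (s : E ⟶ F.presheaf.obj (op ⊤))
    {p : Simplex X} {v : V} (hv : v ∈ p.verts) :
    cellAt (s ≫ toCell F) {v} p = s ≫ res F.presheaf (le_top : Alexandrov.principalOpen p ≤ ⊤) := by
  obtain ⟨x, rfl⟩ := exists_vertex hv
  refine (cellAt_eq (s ≫ toCell F) x.simplexOfDim rfl (Finset.singleton_subset_iff.2 hv)).trans ?_
  refine (congrArg (· ≫ _) ((Category.assoc _ _ _).trans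
    (congrArg (s ≫ ·) (cellLift_π _ _)))).trans ?_
  exact (Category.assoc _ _ _).trans (congrArg (s ≫ ·) (F.presheaf.map_comp _ _).symm)

lemma toCell_d (F : TopCat.Sheaf M (space X)) :
    toCell F ≫ (cellularComplex ((toCellular X M).obj F)).d 0 1 = 0 := by
  refine cell_hom_ext fun t => ?_
  rw [zero_comp, ← cellAt_self]
  obtain ⟨v, w, hvw, ht⟩ := exists_edge t
  rw [cellAt_comp_d_edge _ t le_rfl hvw ht, ← Category.id_comp (toCell F)]
  exact sub_eq_zero.2 ((cellAt_comp_toCell _ (by simp [ht])).trans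
    (cellAt_comp_toCell _ (by simp [ht])).symm)

lemma exact_toCell (F : TopCat.Sheaf M (space X)) :
    (ShortComplex.mk _ _ (toCell_d F)).Exact ∧ Mono (toCell F) := by
  constructor
  · refine exact_of_lift _ fun E (z : E ⟶ (cellularComplex ((toCellular X M).obj F)).X 0) hz => ?_
    have key (x y : Vertex X) (hxy : x.1 < y.1) :
        (z ≫ cellπ _ x.simplexOfDim) ≫ res F.presheaf (inf_le_left :
          Alexandrov.principalOpen x.simplex ⊓ Alexandrov.principalOpen y.simplex ≤ _) =
        (z ≫ cellπ _ y.simplexOfDim) ≫ res F.presheaf inf_le_right := by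
      by_cases h : {x.1, y.1} ∈ X
      · let t : SimplexOfDim X 1 := ⟨⟨_, h⟩, Finset.card_pair hxy.ne⟩
        have hx : x.simplex ≤ t.1 := Finset.singleton_subset_iff.2 (by simp [t])
        have hy : y.simplex ≤ t.1 := Finset.singleton_subset_iff.2 (by simp [t])
        have hd : (z ≫ cellπ _ y.simplexOfDim) ≫ res F.presheaf
              ((Alexandrov.principalOpen_le_iff _).2 hy) =
            (z ≫ cellπ _ x.simplexOfDim) ≫ res F.presheaf
              ((Alexandrov.principalOpen_le_iff _).2 hx) := by
          refine ((cellAt_eq z y.simplexOfDim rfl hy).symm.trans ?_).trans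
            (cellAt_eq z x.simplexOfDim rfl hx)
          refine sub_eq_zero.1 ((cellAt_comp_d_edge z t le_rfl hxy rfl).symm.trans ?_)
          exact (cellAt_self _ t).trans ((congrArg (· ≫ _) hz).trans zero_comp)
        have hW : Alexandrov.principalOpen x.simplex ⊓ Alexandrov.principalOpen y.simplex ≤
            Alexandrov.principalOpen t.1 := fun q hq =>
          Finset.insert_subset (Finset.singleton_subset_iff.1 hq.1) hq.2
        exact (comp_res_res F.presheaf _ hW _).symm.trans
          ((congrArg (· ≫ res F.presheaf hW) hd.symm).trans (comp_res_res F.presheaf _ hW _))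
      · have hW : Alexandrov.principalOpen x.simplex ⊓ Alexandrov.principalOpen y.simplex = ⊥ := by
          refine le_bot_iff.1 fun q hq => h ?_
          exact (X.isRelLowerSet_faces q.verts_mem).2
            (Finset.insert_subset (Finset.singleton_subset_iff.1 hq.1) hq.2)
            (Finset.insert_nonempty _ _)
        have hF : IsZero (F.presheaf.obj (op (Alexandrov.principalOpen x.simplex ⊓
            Alexandrov.principalOpen y.simplex))) := by
          rw [hW]
          exact isZero_sections_bot F
        exact hF.eq_of_tgt _ _
    obtain ⟨s, hs, -⟩ := existsUnique_glue F (starCover X).property E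
      (fun x : Vertex X => z ≫ cellπ _ x.simplexOfDim) fun x y => by
        rcases lt_trichotomy x.1 y.1 with h | h | h
        · exact key x y h
        · obtain rfl : x = y := Subtype.ext h
          rfl
        · have hW : Alexandrov.principalOpen x.simplex ⊓ Alexandrov.principalOpen y.simplex ≤
              Alexandrov.principalOpen y.simplex ⊓ Alexandrov.principalOpen x.simplex :=
            inf_comm _ _ |>.le
          exact (comp_res_res F.presheaf _ hW _).symm.trans
            ((congrArg (· ≫ res F.presheaf hW) (key y x h).symm).trans
              (comp_res_res F.presheaf _ hW _))
    refine ⟨s, cell_hom_ext fun t => ?_⟩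
    obtain ⟨v, hv⟩ := Finset.card_eq_one.1 t.2
    obtain ⟨x, rfl⟩ := exists_vertex (p := t.1) (hv.symm ▸ Finset.mem_singleton_self v)
    obtain rfl : x.simplexOfDim = t := Subtype.ext (Simplex.verts_injective hv.symm)
    exact ((Category.assoc _ _ _).trans (congrArg (s ≫ ·) (cellLift_π _ _))).trans (hs x)
  · refine ⟨fun {E} s t h => ?_⟩
    have hst (x : Vertex X) : t ≫ res F.presheaf (le_top : (starCover X).obj.obj x ≤ ⊤) =
        s ≫ res F.presheaf le_top := by
      have hx : x.1 ∈ x.simplex.verts := Finset.mem_singleton_self _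
      exact (cellAt_comp_toCell t hx).symm.trans ((congrArg (cellAt · {x.1} x.simplex) h.symm).trans
        (cellAt_comp_toCell s hx))
    obtain ⟨r, -, hr⟩ := existsUnique_glue F (starCover X).property E
      (fun x => s ≫ res F.presheaf (le_top : (starCover X).obj.obj x ≤ ⊤)) fun x y => by
        rw [Category.assoc, Category.assoc, res_res, res_res]
    exact (hr s fun _ => rfl).trans (hr t hst).symm

end Augmentation

section Comparison

lemma isoProduct_inv_map {J : Type u} {f g : J → M} [HasBiproduct f] [HasBiproduct g]
    (φ : ∀ j, f j ⟶ g j) : (biproduct.isoProduct f).inv ≫ biproduct.map φ =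
      Limits.Pi.map φ ≫ (biproduct.isoProduct g).inv :=
  biproduct.hom_ext _ _ fun j => by simp

variable [IsGrothendieckAbelian.{u} M]

variable (X M) in
/-- The cellular complex of a sheaf, as a functor. -/
abbrev sheafCell : TopCat.Sheaf M (space X) ⥤ CochainComplex M ℕ :=
  toCellular X M ⋙ cellularComplexFunctor X M

instance : (sheafCell X M).PreservesZeroMorphisms where
  map_zero F G := by
    refine HomologicalComplex.hom_ext _ _ fun n => cell_hom_ext fun s => ?_
    refine (cellπ_naturality _ s).trans ?_
    exact comp_zero.trans zero_comp.symm

lemma shortExact_sheafCell [AB4Star M] (S : ShortComplex (TopCat.Sheaf M (space X)))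
    (hS : S.ShortExact) : (S.map (sheafCell X M)).ShortExact := by
  refine HomologicalComplex.shortExact_of_degreewise_shortExact _ fun n => ?_
  refine ShortComplex.shortExact_of_iso ?_ (shortExact_pi (fun s : SimplexOfDim X n =>
    S.map (sections (T := space X) M (Alexandrov.principalOpen s.1))) fun s =>
      shortExact_sections_principalOpen s.1 S hS)
  exact ShortComplex.isoMk (biproduct.isoProduct _).symm (biproduct.isoProduct _).symm
    (biproduct.isoProduct _).symm
    (isoProduct_inv_map fun s : SimplexOfDim X n => ((toCellular X M).map S.f).app s.1)
    (isoProduct_inv_map fun s : SimplexOfDim X n => ((toCellular X M).map S.g).app s.1)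

variable (X M) in
lemma nonempty_sheafCohomology_iso_cellular [AB4Star M] (k : ℕ) :
    Nonempty (sheafCohomology X M k ≅ cellularCohomology X M k) := by
  obtain ⟨E⟩ := nonempty_injectiveEmbedding (TopCat.Sheaf M (space X))
  let a : globalSections X M ⟶ sheafCell X M ⋙ HomologicalComplex.eval M _ 0 :=
    { app F := toCell F
      naturality F G φ := cell_hom_ext fun s => by
        refine (Category.assoc _ _ _).trans ?_
        refine (congrArg (_ ≫ ·) (cellLift_π _ s)).trans ?_
        refine Eq.trans ?_ (Category.assoc _ _ _).symm
        refine Eq.trans ?_ (congrArg (_ ≫ ·) (cellπ_naturality _ s)).symm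
        refine Eq.trans ?_ (Category.assoc _ _ _)
        refine Eq.trans ?_ (congrArg (· ≫ _) (cellLift_π _ s)).symm
        exact (res_naturality φ.hom le_top).symm }
  exact nonempty_rightDerived_iso E (globalSections X M) (sheafCell X M)
    shortExact_sheafCell
    (fun I _ n => exactAt_of_injective X (sheafCell X M) (n + 1)
      (fun A => exactAt_cellularComplex_godement A n) I)
    a (fun F => toCell_d F) (fun F => exact_toCell F) k

end Comparison

end Cellular

/-! ### Refinements induce homotopic maps of Čech complexes -/

section Homotopy

/-- The sequence `(f x₀, …, f xⱼ, g xⱼ, …, g xₙ)`. -/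
def prism {I J : Type u} (f g : I → J) {n : ℕ} (j : Fin (n + 1)) (x : Fin (n + 1) → I)
    (a : Fin (n + 2)) : J :=
  if j.castSucc < a then g (x (j.predAbove a)) else f (x (j.predAbove a))

lemma prism_congr {I J : Type u} (f g : I → J) {m n : ℕ} {j : Fin (m + 1)} {j' : Fin (n + 1)}
    {x : Fin (m + 1) → I} {x' : Fin (n + 1) → I} {a : Fin (m + 2)} {a' : Fin (n + 2)}
    (h : j.castSucc < a ↔ j'.castSucc < a') (h' : x (j.predAbove a) = x' (j'.predAbove a')) :
    prism f g j x a = prism f g j' x' a' := by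
  unfold prism
  simp only [h, h']

lemma val_succAbove_eq {n : ℕ} (i : Fin (n + 1)) (a : Fin n) :
    (i.succAbove a).val = if a.val < i.val then a.val else a.val + 1 := by
  unfold Fin.succAbove
  simp only [Fin.lt_def, Fin.val_castSucc]
  split_ifs <;> rfl

lemma val_predAbove_eq {n : ℕ} (i : Fin n) (a : Fin (n + 1)) :
    (i.predAbove a).val = if i.val < a.val then a.val - 1 else a.val := by
  unfold Fin.predAbove
  simp only [Fin.lt_def, Fin.val_castSucc]
  split_ifs <;> rfl

variable {T : TopCat.{u}}

lemma formalCoproduct_hom_ext {𝒱 𝒰 : FormalCoproduct.{u} (Opens T)} {f g : 𝒱 ⟶ 𝒰}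
    (h : ∀ i, f.f i = g.f i) : f = g :=
  FormalCoproduct.hom_ext (funext h) fun _ => Subsingleton.elim _ _

lemma inter_le_inter_prism {𝒱 𝒰 : FormalCoproduct.{u} (Opens T)} (f g : 𝒱 ⟶ 𝒰) {n : ℕ}
    (j : Fin (n + 1)) (x : Fin (n + 1) → 𝒱.I) : inter 𝒱 x ≤ inter 𝒰 (prism f.f g.f j x) :=
  le_inter 𝒰 fun a => by
    unfold prism
    split_ifs
    · exact (inter_le 𝒱 x _).trans (g.φ _).le
    · exact (inter_le 𝒱 x _).trans (f.φ _).le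

/-- Refinements of a cover induce homotopic maps of simplicial objects. -/
def cechHomotopy {𝒱 𝒰 : FormalCoproduct.{u} (Opens T)} (f g : 𝒱 ⟶ 𝒰) :
    SimplicialObject.Homotopy (FormalCoproduct.cechFunctor.map f)
      (FormalCoproduct.cechFunctor.map g) where
  h {n} j := ⟨prism f.f g.f (n := n) j, fun x => homOfLE (inter_le_inter_prism f g j x)⟩
  h_zero_comp_δ_zero n := formalCoproduct_hom_ext fun x => funext fun a => by
    change prism f.f g.f 0 x ((0 : Fin (n + 2)).succAbove a) = g.f (x a)
    simp [prism]
  h_last_comp_δ_last n := formalCoproduct_hom_ext fun x => funext fun a => by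
    change prism f.f g.f (Fin.last n) x ((Fin.last (n + 1)).succAbove a) = f.f (x a)
    simp [prism, Fin.le_last]
  h_succ_comp_δ_castSucc_of_lt {n} i j hij := formalCoproduct_hom_ext fun x => funext fun (a : Fin (n + 2)) => by
    refine prism_congr f.f g.f (j := j.succ) (j' := j) (x := x) (x' := x ∘ i.succAbove)
      (a := i.castSucc.succAbove a) (a' := a) ?_ (congrArg x ?_)
    · grind [val_succAbove_eq, val_predAbove_eq]
    · grind [val_succAbove_eq, val_predAbove_eq]
  h_succ_comp_δ_castSucc_succ {n} j := formalCoproduct_hom_ext fun x => funext fun (a : Fin (n + 2)) => by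
    refine prism_congr f.f g.f (j := j.succ) (j' := j.castSucc) (x := x) (x' := x)
      (a := j.castSucc.succ.succAbove a) (a' := j.castSucc.succ.succAbove a) ?_ (congrArg x ?_)
    · grind [val_succAbove_eq, val_predAbove_eq]
    · grind [val_succAbove_eq, val_predAbove_eq]
  h_castSucc_comp_δ_succ_of_lt {n} i j hij := formalCoproduct_hom_ext fun x => funext fun (a : Fin (n + 2)) => by
    refine prism_congr f.f g.f (j := j.castSucc) (j' := j) (x := x) (x' := x ∘ i.succAbove)
      (a := i.succ.succAbove a) (a' := a) ?_ (congrArg x ?_)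
    · grind [val_succAbove_eq, val_predAbove_eq]
    · grind [val_succAbove_eq, val_predAbove_eq]
  h_comp_σ_castSucc_of_le {n} i j hij := formalCoproduct_hom_ext fun x => funext fun (a : Fin (n + 3)) => by
    refine prism_congr f.f g.f (j := j) (j' := j.succ) (x := x) (x' := x ∘ i.predAbove)
      (a := i.castSucc.predAbove a) (a' := a) ?_ (congrArg x ?_)
    · grind [val_succAbove_eq, val_predAbove_eq]
    · grind [val_succAbove_eq, val_predAbove_eq]
  h_comp_σ_succ_of_lt {n} i j hij := formalCoproduct_hom_ext fun x => funext fun (a : Fin (n + 3)) => by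
    refine prism_congr f.f g.f (j := j) (j' := j.castSucc) (x := x) (x' := x ∘ i.predAbove)
      (a := i.succ.predAbove a) (a' := a) ?_ (congrArg x ?_)
    · grind [val_succAbove_eq, val_predAbove_eq]
    · grind [val_succAbove_eq, val_predAbove_eq]

variable {M : Type v} [Category.{u} M] [Abelian M] [IsGrothendieckAbelian.{u} M]

lemma cechComplex_d_eq_unop (𝒰 : FormalCoproduct.{u} (Opens T)) (P : TopCat.Presheaf M T)
    (n : ℕ) : (((cechComplex T M).obj (op 𝒰)).obj P).d n (n + 1) =
      (((AlgebraicTopology.alternatingFaceMapComplex Mᵒᵖ).obj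
        (((SimplicialObject.whiskering _ _).obj
          ((FormalCoproduct.evalOp.{u} (Opens T) M).obj P).rightOp).obj 𝒰.cech)).d (n + 1) n).unop :=
  (CochainComplex.of_d _ _ _).trans
    ((AlgebraicTopology.AlternatingCofaceMapComplex.d_eq_unop_d _ _).trans
      (congrArg Quiver.Hom.unop
        (AlgebraicTopology.alternatingFaceMapComplex_obj_d _ n)).symm)

/-- A homotopy of morphisms of cochain complexes in nonnegative degrees. -/
def cochainHomotopy {K L : CochainComplex M ℕ} (f g : K ⟶ L) (h : ∀ n, K.X (n + 1) ⟶ L.X n)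
    (h_zero : f.f 0 = K.d 0 1 ≫ h 0 + g.f 0)
    (h_succ : ∀ n, f.f (n + 1) =
      K.d (n + 1) (n + 1 + 1) ≫ h (n + 1) + h n ≫ L.d n (n + 1) + g.f (n + 1)) :
    Homotopy f g where
  hom i j := if e : j + 1 = i then (K.XIsoOfEq e.symm).hom ≫ h j else 0
  zero i j e := dif_neg e
  comm n := by
    cases n with
    | zero =>
      rw [dNext_eq (i' := 1) (w := by simp), h_zero]
      simp
    | succ n =>
      rw [dNext_eq (i' := n + 1 + 1) (w := by simp), prevD_eq (j' := n) (w := by simp), h_succ]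
      simp

/-- Refinements of a cover induce homotopic maps of Čech complexes. -/
def cechComplexHomotopy {𝒱 𝒰 : FormalCoproduct.{u} (Opens T)} (f g : 𝒱 ⟶ 𝒰)
    (P : TopCat.Presheaf M T) :
    Homotopy (((cechComplex T M).map f.op).app P) (((cechComplex T M).map g.op).app P) :=
  let H := ((cechHomotopy f g).whiskerRight
    ((FormalCoproduct.evalOp.{u} (Opens T) M).obj P).rightOp).toChainHomotopy
  cochainHomotopy _ _ (fun n => (H.hom n (n + 1)).unop)
    (by
      have h := congrArg Quiver.Hom.unop (H.comm 0)
      rw [prevD_eq (j' := 1) (w := by simp), dNext_eq_zero _ _ (by simp), zero_add] at h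
      exact h.trans (congrArg (fun d => d ≫ _ + _) (cechComplex_d_eq_unop 𝒰 P 0).symm))
    (fun n => by
      have h := congrArg Quiver.Hom.unop (H.comm (n + 1))
      rw [prevD_eq (j' := n + 1 + 1) (w := by simp), dNext_eq (i' := n) (w := by simp),
        add_comm (_ ≫ _)] at h
      exact h.trans (congrArg₂ (fun d d' => d ≫ _ + _ ≫ d' + _)
        (cechComplex_d_eq_unop 𝒰 P (n + 1)).symm (cechComplex_d_eq_unop 𝒱 P n).symm))

lemma cechDiagram_map_eq {𝒱 𝒰 : Cover T} (f g : 𝒱 ⟶ 𝒰) (k : ℕ) :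
    (cechDiagram T M k).map f.op = (cechDiagram T M k).map g.op := by
  ext F
  exact (cechComplexHomotopy f.hom g.hom F.presheaf).homologyMap_eq k

end Homotopy

/-! ### The colimit over all covers -/

section Colimit

variable {V : Type u} (X : PreAbstractSimplicialComplex V)
variable (M : Type v) [Category.{u} M] [Abelian M] [IsGrothendieckAbelian.{u} M]

/-- The cocone exhibiting the Čech cohomology of the star cover as the colimit of the Čech
cohomology over all covers. -/
def starCocone (k : ℕ) : Cocone (cechDiagram (space X) M k) where
  pt := (cechDiagram (space X) M k).obj (op (starCover X))
  ι :=
    { app 𝒰 := (cechDiagram (space X) M k).map (nonempty_starCover_hom X 𝒰.unop).some.op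
      naturality 𝒰 𝒱 f := by
        refine ((cechDiagram (space X) M k).map_comp _ _).symm.trans ?_
        exact (cechDiagram_map_eq (_ ≫ f.unop) _ k).trans (Category.comp_id _).symm }

/-- Čech cohomology of the star cover is the colimit of the Čech cohomology over all covers. -/
def isColimitStarCocone (k : ℕ) : IsColimit (starCocone X M k) where
  desc s := s.ι.app (op (starCover X))
  fac s 𝒰 := s.w _
  uniq s m h := by
    refine Eq.trans ?_ (h (op (starCover X)))
    have : (starCocone X M k).ι.app (op (starCover X)) = 𝟙 _ :=
      (cechDiagram_map_eq _ (𝟙 _) k).trans ((cechDiagram (space X) M k).map_id _)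
    rw [this]
    exact (Category.id_comp _).symm

end Colimit

end

end SimplicialSheaf

theorem theorem742 {V : Type u} [LinearOrder V] (X : PreAbstractSimplicialComplex V)
    (M : Type v) [Category.{u} M] [Abelian M] [IsGrothendieckAbelian.{u} M] [AB4Star M] :
    -- sheaf cohomology is the colimit of Čech cohomology over all open covers
    (∀ k : ℕ, ∃ c : Cocone (SimplicialSheaf.cechDiagram (SimplicialSheaf.space X) M k),
      Nonempty (IsColimit c) ∧ Nonempty (c.pt ≅ SimplicialSheaf.sheafCohomology X M k)) ∧
    -- sheaves on `X` are the same as functors on the face relation poset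
    (SimplicialSheaf.toCellular X M).IsEquivalence ∧
    -- the nerve of the vertex star cover is `X`, and it refines every open cover
    (SimplicialSheaf.nerve (SimplicialSheaf.starCover X)).map (fun x : SimplicialSheaf.Vertex X => x.1) = X ∧
    (∀ 𝒰 : SimplicialSheaf.Cover (SimplicialSheaf.space X),
      Nonempty (SimplicialSheaf.starCover X ⟶ 𝒰)) ∧
    -- if `X` is finite, then sheaf cohomology, Čech cohomology of the vertex star cover and
    -- the cohomology of the cellular cochain complex agree
    (∀ [Finite (SimplicialSheaf.Simplex X)] (k : ℕ),
      Nonempty (SimplicialSheaf.sheafCohomology X M k ≅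
        SimplicialSheaf.cellularCohomology X M k) ∧
      Nonempty ((SimplicialSheaf.cechDiagram (SimplicialSheaf.space X) M k).obj
        (op (SimplicialSheaf.starCover X)) ≅ SimplicialSheaf.cellularCohomology X M k)) := by
  refine ⟨fun k => ⟨SimplicialSheaf.starCocone X M k,
    ⟨SimplicialSheaf.isColimitStarCocone X M k⟩, ?_⟩,
    SimplicialSheaf.toCellular_isEquivalence X M, SimplicialSheaf.map_nerve_starCover X,
    SimplicialSheaf.nonempty_starCover_hom X, fun {_} k => ?_⟩
  · obtain ⟨e⟩ := SimplicialSheaf.nonempty_sheafCohomology_iso_cech (X := X) (M := M) k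
    exact ⟨e.symm⟩
  · obtain ⟨e⟩ := SimplicialSheaf.nonempty_sheafCohomology_iso_cech (X := X) (M := M) k
    obtain ⟨e'⟩ := SimplicialSheaf.nonempty_sheafCohomology_iso_cellular X M k
    exact ⟨⟨e'⟩, ⟨e.symm ≪≫ e'⟩⟩
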